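/- Let $Q\neq 0$ be a Borel measure on $\mathbb R$, let $Z(\beta)=\int e^{\beta x}\,dQ(x)$, let $\Gamma^{\mathrm{can}}=\{\beta\in\mathbb R : Z(\beta)<\infty\}$, and for $\beta\in\Gamma^{\mathrm{can}}$ let $P_\beta$ be the probability measure with density $p_\beta(x)=\frac{dP_\beta}{dQ}(x)=e^{\beta x}/Z(\beta)$. Let $b$ be an interior point of $\Gamma^{\mathrm{can}}$, and let $\Gamma=\{\beta\in\Gamma^{\mathrm{can}} : \beta\ge b\}$ be the parameter set of the corresponding left-truncated exponential family $\{P_\beta : \beta\in\Gamma\}$. Put $\beta_{\sup}=\sup\Gamma\in(-\infty,\infty]$, and write $D(\cdot\Vert\cdot)$ for information (Kullback--Leibler) divergence and $D(\beta\Vert\beta')=D(P_\beta\Vert P_{\beta'})$. Then the following statements are equivalent. 1. The Shtarkov integral $S=\int \sup_{\beta\in\Gamma}p_\beta(x)\,dQ(x)$ is finite. 2. The minimax individual-sequence regret $$\inf_R\ \operatorname*{ess\,sup}_{x\sim Q}\ \log\frac{\sup_{\beta\in\Gamma}p_\beta(x)}{\frac{dR}{dQ}(x)}$$ is finite, where $R$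 ranges over all Borel probability measures on $\mathbb R$ and $\frac{dR}{dQ}$ is the density of the absolutely continuous part of $R$. 3. The minimax expected redundancy $\inf_R\sup_{\beta\in\Gamma}D(P_\beta\Vert R)$ is finite, where $R$ ranges over all Borel probability measures on $\mathbb R$. 4. There is a probability measure $Q_{\mathrm{dom}}$ on $\mathbb R$ with $\sup_{\beta\in\Gamma}D(P_\beta\Vert Q_{\mathrm{dom}})<\infty$. 5. There is $\beta_1\in\Gamma$ with $\sup_{\beta\in\Gamma}D(P_\beta\Vert P_{\beta_1})<\infty$. 6. The information channel $\beta\mapsto P_\beta$ with input alphabet $\Gamma$ has finite capacity, i.e. $\sup_\pi\int_\Gamma D\bigl(P_\beta\Vert P_\pi\bigr)\,d\pi(\beta)<\infty$, where $\pi$ ranges over all Borel probability measures on $\Gamma$ and $P_\pi=\int_\Gamma P_\beta\,d\pi(\beta)$. 7. There is $\beta_0\in\Gamma$ such that $\lim_{\beta\uparrow\beta_{\sup}}D(\beta_0\Vert\beta)$ or $\lim_{\beta\uparrow\beta_{\sup}}D(\beta\Vert\beta_0)$ exists and is finite. -/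

import Mathlib

open MeasureTheory ProbabilityTheory Filter Topology
open scoped ENNReal NNReal

noncomputable section

namespace ExpFamily

/-- The canonical parameter space `{β | Z(β) < ∞}`, with `Z(β) = ∫ exp (β x) dQ(x)`. -/
def canonicalSpace (Q : Measure ℝ) : Set ℝ := {β | ∫⁻ x, ENNReal.ofReal (Real.exp (β * x)) ∂Q < ∞}

/-- The partition function `Z(β) = ∫ exp (β x) dQ(x)`. -/
def partitionFunction (Q : Measure ℝ) (β : ℝ) : ℝ := ∫ x, Real.exp (β * x) ∂Q

/-- The density `dP_β/dQ (x) = exp (β x) / Z(β)`. -/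
def density (Q : Measure ℝ) (β x : ℝ) : ℝ≥0∞ :=
  ENNReal.ofReal (Real.exp (β * x) / partitionFunction Q β)

/-- The element `P_β` of the exponential family generated by `Q`. -/
def dist (Q : Measure ℝ) (β : ℝ) : Measure ℝ := Q.withDensity (density Q β)

/-- A measure with a nonempty canonical parameter space is σ-finite. -/
theorem sigmaFinite_of_mem {Q : Measure ℝ} {b : ℝ} (hb : b ∈ canonicalSpace Q) :
    SigmaFinite Q := by
  have hm : Measurable fun x : ℝ => ENNReal.ofReal (Real.exp (b * x)) := by fun_prop
  have hfin : IsFiniteMeasure (Q.withDensity fun x => ENNReal.ofReal (Real.exp (b * x))) :=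
    isFiniteMeasure_withDensity (ne_of_lt hb)
  generalize hν : Q.withDensity (fun x => ENNReal.ofReal (Real.exp (b * x))) = ν at hfin
  have hm' : Measurable fun x : ℝ => Real.toNNReal (Real.exp (-(b * x))) := by fun_prop
  have h : ν.withDensity (fun x => ((Real.toNNReal (Real.exp (-(b * x))) : ℝ≥0) : ℝ≥0∞)) = Q := by
    rw [← hν, ← withDensity_mul _ hm hm'.coe_nnreal_ennreal]
    conv_rhs => rw [← withDensity_one (μ := Q)]
    congr 1
    funext x
    change ENNReal.ofReal (Real.exp (b * x)) * ENNReal.ofReal (Real.exp (-(b * x))) = 1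
    rw [← ENNReal.ofReal_mul (Real.exp_nonneg _), ← Real.exp_add]
    simp
  exact h ▸ SigmaFinite.withDensity (fun x => Real.toNNReal (Real.exp (-(b * x))))

/-- `β ↦ P_β` is a measurable family of measures, hence a genuine channel. -/
theorem measurable_dist {Q : Measure ℝ} {b : ℝ} (hb : b ∈ canonicalSpace Q) :
    Measurable (dist Q) := by
  have := sigmaFinite_of_mem hb
  have hZ : Measurable (partitionFunction Q) := by
    have : StronglyMeasurable fun p : ℝ × ℝ => Real.exp (p.1 * p.2) :=
      (by fun_prop : Measurable fun p : ℝ × ℝ => Real.exp (p.1 * p.2)).stronglyMeasurable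
    exact (this.integral_prod_right (ν := Q)).measurable
  have hd : Measurable fun p : ℝ × ℝ => density Q p.1 p.2 := by
    unfold density
    fun_prop
  refine Measure.measurable_of_measurable_coe _ fun s hs => ?_
  simp only [dist, withDensity_apply _ hs]
  exact hd.lintegral_prod_right' (ν := Q.restrict s)

/-- For `β` in the canonical parameter space, `P_β` is a probability measure. -/
theorem isProbabilityMeasure_dist {Q : Measure ℝ} (hQ : Q ≠ 0) {β : ℝ}
    (hβ : β ∈ canonicalSpace Q) : IsProbabilityMeasure (dist Q β) := by
  have hi : Integrable (fun x => Real.exp (β * x)) Q := by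
    refine ⟨by fun_prop, ?_⟩
    rw [hasFiniteIntegral_iff_ofReal (ae_of_all _ fun x => Real.exp_nonneg _)]
    exact hβ
  have : NeZero Q := ⟨hQ⟩
  exact isProbabilityMeasure_tilted hi

/-- `Γ` is the parameter set of a left-truncated exponential family: the canonical parameter space
is cut off on the left at an interior point `b`, and all parameters `β ≥ b` are kept. -/
def IsLeftTruncated (Q : Measure ℝ) (Γ : Set ℝ) : Prop :=
  ∃ b ∈ interior (canonicalSpace Q), Γ = {β ∈ canonicalSpace Q | b ≤ β}

/-- The maximum likelihood `sup_{β ∈ Γ} dP_β/dQ (x)`; it is a supremum, so that it is also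
meaningful at points `x` where it is only approached, as `β` tends to the end of `Γ`. -/
def maxLikelihood (Q : Measure ℝ) (Γ : Set ℝ) (x : ℝ) : ℝ≥0∞ := ⨆ β ∈ Γ, density Q β x

/-- If a maximum likelihood estimate `β_x` exists in `Γ`, the maximum likelihood is the density
at `β_x`. -/
theorem maxLikelihood_eq {Q : Measure ℝ} {Γ : Set ℝ} {x βx : ℝ} (hmem : βx ∈ Γ)
    (hmax : ∀ β ∈ Γ, density Q β x ≤ density Q βx x) :
    maxLikelihood Q Γ x = density Q βx x :=
  le_antisymm (iSup₂_le hmax) (le_iSup₂_of_le βx hmem le_rfl)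

/-- The Shtarkov integral. -/
def shtarkov (Q : Measure ℝ) (Γ : Set ℝ) : ℝ≥0∞ := ∫⁻ x, maxLikelihood Q Γ x ∂Q

/-- The worst-case individual-sequence regret (in nats) of the probability measure `R`: the
supremum over outcomes `x` of `log (sup_β dP_β/dQ (x)) - log (dR/dQ (x))`, where outcomes in a
`Q`-null set are disregarded, since densities are only determined up to such sets. -/
def regret (Q : Measure ℝ) (Γ : Set ℝ) (R : Measure ℝ) : EReal :=
  essSup (fun x => ENNReal.log (maxLikelihood Q Γ x / R.rnDeriv Q x)) Q

/-- The minimax individual-sequence regret. -/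
def minimaxRegret (Q : Measure ℝ) (Γ : Set ℝ) : EReal :=
  ⨅ (R : Measure ℝ) (_ : IsProbabilityMeasure R), regret Q Γ R

/-- The worst-case expected redundancy `sup_{β ∈ Γ} D(P_β ‖ R)` of the probability measure `R`. -/
def redundancy (Q : Measure ℝ) (Γ : Set ℝ) (R : Measure ℝ) : ℝ≥0∞ :=
  ⨆ β ∈ Γ, InformationTheory.klDiv (dist Q β) R

/-- The minimax expected redundancy. -/
def minimaxRedundancy (Q : Measure ℝ) (Γ : Set ℝ) : ℝ≥0∞ :=
  ⨅ (R : Measure ℝ) (_ : IsProbabilityMeasure R), redundancy Q Γ R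

/-- The output distribution `∫ P_β dπ(β)` of the channel `β ↦ P_β` for the input distribution
`π` on `Γ`. -/
def outputDist (Q : Measure ℝ) (Γ : Set ℝ) (π : Measure Γ) : Measure ℝ :=
  π.bind fun β => dist Q β

/-- The mutual information between input and output of the channel `β ↦ P_β`. -/
def mutualInfo (Q : Measure ℝ) (Γ : Set ℝ) (π : Measure Γ) : ℝ≥0∞ :=
  ∫⁻ β : Γ, InformationTheory.klDiv (dist Q β) (outputDist Q Γ π) ∂π

/-- The capacity of the channel `β ↦ P_β` with input alphabet `Γ`. -/
def capacity (Q : Measure ℝ) (Γ : Set ℝ) : ℝ≥0∞ :=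
  ⨆ (π : Measure Γ) (_ : IsProbabilityMeasure π), mutualInfo Q Γ π

/-- The right end point `β_sup ∈ (-∞, ∞]` of the parameter set. -/
def rightEnd (Γ : Set ℝ) : EReal := ⨆ β ∈ Γ, (β : EReal)

/-- The filter `β ↑ β_sup` of real parameters (with `β_sup` possibly infinite). -/
def toRightEnd (Γ : Set ℝ) : Filter ℝ := comap (fun β : ℝ => (β : EReal)) (𝓝[<] rightEnd Γ)

end ExpFamily

end

/-!
The proof compares each of the statements with a property of `Q` and `Γ` alone,
`ExpFamily.IsClosedAtRightEnd`: either `Γ` has a largest element `s`, or `Q` has an atom at the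
right end `x₀` of its support, so that `P_β` converges to the point mass at `x₀` as `β → ∞`.

If this property holds, then all densities `p_β`, `β ∈ Γ`, are bounded by a constant times
`p_b + p_s`, respectively `p_b` (`exists_density_le_of_le`, `exists_density_le_of_atom`). This makes
the Shtarkov integral finite, and in the second case it also bounds `D(P_β ‖ P_b)`. This divergence
increases with `β` (`klDiv_dist_mono`), so that it has a finite limit. In the first case the formula
for the divergence in terms of means and `log Z` (`klDiv_dist`) shows that `D(P_β ‖ P_s)` is bounded
and that `D(P_b ‖ P_β)` has a finite limit.

If the property fails, then all mass of `P_β` escapes to the right end of the support of `Q` as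
`β ↑ β_sup` (`tendsto_dist_Iic`), while no single `P_β` has an atom there. Hence there are parameters
`β₀, β₁, …`, as close to `β_sup` as desired, such that each `P_{β_n}` puts half of its mass on an
interval `(K n, K (n + 1)]` (`exists_concentrating_seq`). By a variational bound for the divergence,
the average of `D(P_{β_i} ‖ R)` over `i < n` is at least `(log n) / 2 - 1` for every probability
measure `R` (`mul_log_le_sum_klDiv`). Thus no redundancy `sup_β D(P_β ‖ R)` is finite, uniform
distributions on finitely many parameters show that the capacity is infinite, and `D(P_β ‖ P_β₀)`
does not stay bounded as `β ↑ β_sup`. The escape of mass also gives `D(P_β₀ ‖ P_β) → ∞`.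

The remaining implications use the normalized maximum likelihood distribution, whose regret is the
logarithm of the Shtarkov integral and minimal, and the bound of the divergence by the
`χ²`-divergence (`klDiv_withDensity_le`), which bounds the redundancy of this distribution and the
capacity by the Shtarkov integral plus one.
-/

/-! ### Bounds on the Kullback–Leibler divergence -/

section KullbackLeibler

open InformationTheory

/-- The Fenchel–Young inequality for the function `klFun` and its conjugate `s ↦ exp s - 1`. -/
theorem mul_le_klFun_add_exp_sub_one {s t : ℝ} (ht : 0 ≤ t) :
    s * t ≤ klFun t + (Real.exp s - 1) := by
  rw [klFun_apply]
  rcases ht.eq_or_lt with rfl | ht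
  · simpa using (Real.exp_pos s).le
  · have h := Real.add_one_le_exp (s - Real.log t)
    rw [Real.exp_sub, Real.exp_log ht, le_div_iff₀ ht] at h
    linarith

theorem klFun_le_sq_add_one {t : ℝ} (ht : 0 ≤ t) : klFun t ≤ t * t + 1 := by
  rw [klFun_apply]
  rcases ht.eq_or_lt with rfl | ht
  · simp
  · nlinarith [Real.log_le_sub_one_of_pos ht]

variable {α : Type*} [MeasurableSpace α]

/-- The variational lower bound on the divergence for the test function `s • 1_A`. It serves as a
substitute for the data processing inequality for the partition `{A, Aᶜ}`. -/
theorem mul_measure_le_klDiv_add (μ ν : Measure α) [IsFiniteMeasure μ] [IsFiniteMeasure ν]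
    (A : Set α) {s : ℝ} (hs : 0 ≤ s) :
    ENNReal.ofReal s * μ A ≤ klDiv μ ν + ENNReal.ofReal (Real.exp s - 1) * ν A := by
  by_cases hμν : μ ≪ ν
  · have hpt : ∀ᵐ x ∂ν, ENNReal.ofReal s * μ.rnDeriv ν x ≤
        ENNReal.ofReal (klFun (μ.rnDeriv ν x).toReal) + ENNReal.ofReal (Real.exp s - 1) := by
      filter_upwards [μ.rnDeriv_lt_top ν] with x hx
      conv_lhs => rw [← ENNReal.ofReal_toReal hx.ne]
      rw [← ENNReal.ofReal_mul hs, ← ENNReal.ofReal_add (klFun_nonneg ENNReal.toReal_nonneg)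
        (by linarith [Real.one_le_exp hs])]
      exact ENNReal.ofReal_le_ofReal (mul_le_klFun_add_exp_sub_one ENNReal.toReal_nonneg)
    calc ENNReal.ofReal s * μ A
        = ∫⁻ x in A, ENNReal.ofReal s * μ.rnDeriv ν x ∂ν := by
          rw [lintegral_const_mul _ (μ.measurable_rnDeriv ν), Measure.setLIntegral_rnDeriv hμν]
      _ ≤ ∫⁻ x in A, (ENNReal.ofReal (klFun (μ.rnDeriv ν x).toReal)
            + ENNReal.ofReal (Real.exp s - 1)) ∂ν :=
          lintegral_mono_ae (ae_restrict_of_ae hpt)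
      _ = (∫⁻ x in A, ENNReal.ofReal (klFun (μ.rnDeriv ν x).toReal) ∂ν)
            + ENNReal.ofReal (Real.exp s - 1) * ν A := by
          rw [lintegral_add_right _ measurable_const, setLIntegral_const]
      _ ≤ _ := by
          rw [klDiv_eq_lintegral_klFun_of_ac hμν]
          gcongr
          exact Measure.restrict_le_self
  · simp [klDiv_of_not_ac hμν]

/-- If `n` distributions are mostly concentrated on disjoint sets, then their average divergence
from any common probability measure is of the order of `log n`. -/
theorem mul_log_le_sum_klDiv {n : ℕ} (μ : Fin n → Measure α) [∀ i, IsProbabilityMeasure (μ i)]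
    (ν : Measure α) [IsProbabilityMeasure ν] (A : Fin n → Set α) (hA : ∀ i, MeasurableSet (A i))
    (hdisj : Pairwise (Function.onFun Disjoint A)) (hμ : ∀ i, (1 / 2 : ℝ≥0∞) ≤ μ i (A i)) :
    n * ENNReal.ofReal (Real.log n / 2) ≤ (∑ i, klDiv (μ i) ν) + n := by
  rcases n.eq_zero_or_pos with rfl | hn
  · simp
  have hn' : (1 : ℝ) ≤ n := by exact_mod_cast hn
  have hlog : 0 ≤ Real.log n := Real.log_nonneg hn'
  -- The test functions are `log n • 1_{A i}`, the best choice when `ν (A i) = 1 / n`.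
  have hexp : ENNReal.ofReal (Real.exp (Real.log n) - 1) ≤ n := by
    rw [Real.exp_log (by linarith)]
    exact (ENNReal.ofReal_le_ofReal (sub_le_self _ zero_le_one)).trans_eq (ENNReal.ofReal_natCast n)
  calc n * ENNReal.ofReal (Real.log n / 2)
      = ∑ _i : Fin n, ENNReal.ofReal (Real.log n) * (1 / 2 : ℝ≥0∞) := by
        rw [Finset.sum_const, Finset.card_univ, Fintype.card_fin, nsmul_eq_mul,
          ENNReal.ofReal_div_of_pos (by norm_num), mul_one_div]
        simp
    _ ≤ ∑ i, (klDiv (μ i) ν + n * ν (A i)) := by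
        refine Finset.sum_le_sum fun i _ => ?_
        calc ENNReal.ofReal (Real.log n) * (1 / 2 : ℝ≥0∞)
            ≤ ENNReal.ofReal (Real.log n) * μ i (A i) := by gcongr; exact hμ i
          _ ≤ _ := mul_measure_le_klDiv_add (μ i) ν (A i) hlog
          _ ≤ _ := by gcongr
    _ = (∑ i, klDiv (μ i) ν) + n * ν (⋃ i, A i) := by
        rw [Finset.sum_add_distrib, ← Finset.mul_sum, measure_iUnion hdisj hA, tsum_fintype]
    _ ≤ _ := by
        gcongr
        exact (mul_le_mul_right prob_le_one _).trans_eq (mul_one _)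

theorem withDensity_withDensity_div (Q : Measure α) {p m : α → ℝ≥0∞} (hp : Measurable p)
    (hm : Measurable m) (hm0 : ∀ᵐ x ∂Q, m x ≠ 0) (hmt : ∀ᵐ x ∂Q, m x ≠ ∞) :
    (Q.withDensity m).withDensity (fun x => p x / m x) = Q.withDensity p := by
  change (Q.withDensity m).withDensity (p / m) = Q.withDensity p
  rw [← withDensity_mul _ hm (hp.div hm)]
  refine withDensity_congr_ae ?_
  filter_upwards [hm0, hmt] with x h0 ht
  exact ENNReal.mul_div_cancel h0 ht

theorem rnDeriv_withDensity_withDensity (Q : Measure α) {p m : α → ℝ≥0∞}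
    [IsFiniteMeasure (Q.withDensity m)] (hp : Measurable p) (hm : Measurable m)
    (hm0 : ∀ᵐ x ∂Q, m x ≠ 0) (hmt : ∀ᵐ x ∂Q, m x ≠ ∞) :
    (Q.withDensity p).rnDeriv (Q.withDensity m) =ᵐ[Q.withDensity m] fun x => p x / m x := by
  rw [← withDensity_withDensity_div Q hp hm hm0 hmt]
  exact Measure.rnDeriv_withDensity _ (hp.div hm)

/-- The divergence is bounded by the `χ²`-divergence, up to an additive constant. -/
theorem klDiv_withDensity_le (Q : Measure α) {p m : α → ℝ≥0∞} [IsFiniteMeasure (Q.withDensity p)]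
    [IsProbabilityMeasure (Q.withDensity m)] (hp : Measurable p) (hm : Measurable m)
    (hm0 : ∀ᵐ x ∂Q, m x ≠ 0) (hmt : ∀ᵐ x ∂Q, m x ≠ ∞) :
    klDiv (Q.withDensity p) (Q.withDensity m) ≤ (∫⁻ x, p x * (p x / m x) ∂Q) + 1 := by
  have hac : Q.withDensity p ≪ Q.withDensity m := by
    rw [← withDensity_withDensity_div Q hp hm hm0 hmt]
    exact withDensity_absolutelyContinuous _ _
  rw [klDiv_eq_lintegral_klFun_of_ac hac]
  calc ∫⁻ x, ENNReal.ofReal (klFun ((Q.withDensity p).rnDeriv (Q.withDensity m) x).toReal)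
          ∂(Q.withDensity m)
      ≤ ∫⁻ x, (p x / m x * (p x / m x) + 1) ∂(Q.withDensity m) := by
        refine lintegral_mono_ae ?_
        filter_upwards [rnDeriv_withDensity_withDensity Q hp hm hm0 hmt] with x hx
        rw [hx]
        calc ENNReal.ofReal (klFun (p x / m x).toReal)
            ≤ ENNReal.ofReal ((p x / m x).toReal * (p x / m x).toReal + 1) :=
              ENNReal.ofReal_le_ofReal (klFun_le_sq_add_one ENNReal.toReal_nonneg)
          _ ≤ p x / m x * (p x / m x) + 1 := by
              rw [ENNReal.ofReal_add (by positivity) zero_le_one, ENNReal.ofReal_one,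
                ENNReal.ofReal_mul ENNReal.toReal_nonneg]
              gcongr <;> exact ENNReal.ofReal_toReal_le
    _ = (∫⁻ x, p x / m x * (p x / m x) ∂(Q.withDensity m)) + 1 := by
        rw [lintegral_add_right _ measurable_const]
        simp
    _ = _ := by
        congr 1
        refine (lintegral_withDensity_eq_lintegral_mul _ hm
          ((hp.div hm).mul (hp.div hm))).trans ?_
        refine lintegral_congr_ae ?_
        filter_upwards [hm0, hmt] with x h0 ht
        simp only [Pi.mul_apply, Pi.div_apply]
        rw [← mul_assoc, ENNReal.mul_div_cancel h0 ht]

end KullbackLeibler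

namespace ExpFamily

/-! ### Exponential families -/

variable {Q : Measure ℝ} {Γ : Set ℝ} {b β β' s : ℝ}

theorem canonicalSpace_eq_integrableExpSet (Q : Measure ℝ) :
    canonicalSpace Q = integrableExpSet id Q := by
  ext β
  refine ⟨fun h => ⟨by fun_prop, ?_⟩, fun h => ?_⟩
  · rw [hasFiniteIntegral_iff_ofReal (ae_of_all _ fun x => Real.exp_nonneg _)]
    exact h
  · exact (hasFiniteIntegral_iff_ofReal (ae_of_all _ fun x => Real.exp_nonneg _)).1 h.2

theorem integrable_exp (hβ : β ∈ canonicalSpace Q) : Integrable (fun x => Real.exp (β * x)) Q := by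
  rw [canonicalSpace_eq_integrableExpSet] at hβ
  exact hβ

theorem mem_canonicalSpace_of_le_of_le (hb : b ∈ canonicalSpace Q) (hs : s ∈ canonicalSpace Q)
    (hbβ : b ≤ β) (hβs : β ≤ s) : β ∈ canonicalSpace Q := by
  rw [canonicalSpace_eq_integrableExpSet]
  exact integrable_exp_mul_of_le_of_le (integrable_exp hb) (integrable_exp hs) hbβ hβs

theorem partitionFunction_pos (hQ : Q ≠ 0) (hβ : β ∈ canonicalSpace Q) :
    0 < partitionFunction Q β := by
  have : NeZero Q := ⟨hQ⟩
  exact integral_exp_pos (integrable_exp hβ)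

theorem ofReal_partitionFunction (hβ : β ∈ canonicalSpace Q) :
    ENNReal.ofReal (partitionFunction Q β) = ∫⁻ x, ENNReal.ofReal (Real.exp (β * x)) ∂Q :=
  ofReal_integral_eq_lintegral_ofReal (integrable_exp hβ) (ae_of_all _ fun _ => Real.exp_nonneg _)

theorem measurable_density (Q : Measure ℝ) (β : ℝ) : Measurable (density Q β) := by
  unfold density
  fun_prop

theorem density_ne_zero (hQ : Q ≠ 0) (hβ : β ∈ canonicalSpace Q) (x : ℝ) :
    density Q β x ≠ 0 := by
  have := partitionFunction_pos hQ hβ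
  exact (ENNReal.ofReal_pos.2 (by positivity)).ne'

theorem density_ne_top (Q : Measure ℝ) (β x : ℝ) : density Q β x ≠ ∞ := ENNReal.ofReal_ne_top

theorem lintegral_density (hQ : Q ≠ 0) (hβ : β ∈ canonicalSpace Q) :
    ∫⁻ x, density Q β x ∂Q = 1 := by
  have := isProbabilityMeasure_dist hQ hβ
  rw [← setLIntegral_univ, ← withDensity_apply _ MeasurableSet.univ]
  exact measure_univ (μ := dist Q β)

/-- The divergence between two members of the family, in terms of the mean of the first one and
the logarithm of the partition function. -/
theorem klDiv_dist (hQ : Q ≠ 0) (hβ : β ∈ canonicalSpace Q) (hβ' : β' ∈ canonicalSpace Q)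
    (hint : Integrable (fun x => x) (dist Q β)) :
    InformationTheory.klDiv (dist Q β) (dist Q β') = ENNReal.ofReal ((β - β') * (∫ x, x ∂dist Q β)
        - Real.log (partitionFunction Q β) + Real.log (partitionFunction Q β')) ∧
      0 ≤ (β - β') * (∫ x, x ∂dist Q β)
        - Real.log (partitionFunction Q β) + Real.log (partitionFunction Q β') := by
  have := isProbabilityMeasure_dist hQ hβ
  have := isProbabilityMeasure_dist hQ hβ'
  have hZ := partitionFunction_pos hQ hβ
  have hZ' := partitionFunction_pos hQ hβ'
  have hac : dist Q β ≪ dist Q β' := by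
    unfold dist
    rw [← withDensity_withDensity_div Q (measurable_density Q β) (measurable_density Q β')
      (ae_of_all _ (density_ne_zero hQ hβ')) (ae_of_all _ (density_ne_top Q β'))]
    exact withDensity_absolutelyContinuous _ _
  have hd := hac.ae_le (show (dist Q β).rnDeriv (dist Q β') =ᵐ[dist Q β'] _ from
    have : IsFiniteMeasure (Q.withDensity (density Q β')) :=
      inferInstanceAs (IsFiniteMeasure (dist Q β'))
    rnDeriv_withDensity_withDensity Q (measurable_density Q β)
      (measurable_density Q β') (ae_of_all _ (density_ne_zero hQ hβ'))
      (ae_of_all _ (density_ne_top Q β')))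
  have hllr : llr (dist Q β) (dist Q β') =ᵐ[dist Q β] fun x => (β - β') * x
      + (Real.log (partitionFunction Q β') - Real.log (partitionFunction Q β)) := by
    filter_upwards [hd] with x hx
    rw [llr, hx, density, density, ← ENNReal.ofReal_div_of_pos (by positivity),
      ENNReal.toReal_ofReal (by positivity), Real.log_div (by positivity) (by positivity),
      Real.log_div (by positivity) (by positivity), Real.log_div (by positivity) (by positivity),
      Real.log_exp, Real.log_exp]
    ring
  have hi : Integrable (llr (dist Q β) (dist Q β')) (dist Q β) :=
    ((hint.const_mul _).add (integrable_const _)).congr hllr.symm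
  have hval : ∫ x, llr (dist Q β) (dist Q β') x ∂dist Q β = (β - β') * (∫ x, x ∂dist Q β)
        - Real.log (partitionFunction Q β) + Real.log (partitionFunction Q β') := by
    rw [integral_congr_ae hllr, integral_add (hint.const_mul _) (integrable_const _),
      integral_const_mul, integral_const]
    simp
    ring
  rw [← hval, ← InformationTheory.toReal_klDiv_of_measure_eq hac (by simp)]
  exact ⟨(ENNReal.ofReal_toReal (InformationTheory.klDiv_ne_top hac hi)).symm,
    ENNReal.toReal_nonneg⟩

theorem integrable_id_dist (hβ : β ∈ interior (canonicalSpace Q)) :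
    Integrable (fun x => x) (dist Q β) := by
  change Integrable _ (Q.tilted fun x => β * x)
  rw [integrable_tilted_iff (integrable_exp (interior_subset hβ))]
  rw [canonicalSpace_eq_integrableExpSet] at hβ
  simpa [mul_comm] using integrable_pow_mul_exp_of_mem_interior_integrableExpSet hβ 1

/-! ### Left-truncated parameter sets -/

/-- The shape of the parameter set and of the filter `β ↑ β_sup` in the two cases `β_sup = ∞` and
`β_sup < ∞`; in the second one `β_sup` itself may or may not belong to the parameter set. -/
theorem leftTruncated_cases (hb : b ∈ interior (canonicalSpace Q))
    (hΓ : Γ = {β ∈ canonicalSpace Q | b ≤ β}) :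
    (Γ = Set.Ici b ∧ toRightEnd Γ = atTop) ∨
      ∃ s, b < s ∧ Set.Ico b s ⊆ Γ ∧ Γ ⊆ Set.Icc b s ∧ toRightEnd Γ = 𝓝[<] s := by
  have hbΓ : b ∈ Γ := hΓ ▸ ⟨interior_subset hb, le_rfl⟩
  have hle : ∀ β ∈ Γ, (β : EReal) ≤ rightEnd Γ := fun β hβ => le_iSup₂ (f := fun β (_ : β ∈ Γ) =>
    (β : EReal)) β hβ
  have hmem : ∀ β, b ≤ β → (β : EReal) < rightEnd Γ → β ∈ Γ := by
    intro β hbβ hβ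
    obtain ⟨β₂, h⟩ := lt_iSup_iff.1 hβ
    obtain ⟨h₂, hlt⟩ := lt_iSup_iff.1 h
    rw [hΓ] at h₂ ⊢
    exact ⟨mem_canonicalSpace_of_le_of_le (interior_subset hb) h₂.1 hbβ
      (EReal.coe_lt_coe_iff.1 hlt).le, hbβ⟩
  have hlt : (b : EReal) < rightEnd Γ := by
    obtain ⟨c, hbc, hc⟩ := ((show ∀ᶠ x in 𝓝[>] b, x ∈ canonicalSpace Q from
      nhdsWithin_le_nhds (mem_interior_iff_mem_nhds.1 hb)).and self_mem_nhdsWithin).exists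
    exact (EReal.coe_lt_coe_iff.2 hc).trans_le (hle c (hΓ ▸ ⟨hbc, le_of_lt hc⟩))
  induction h : rightEnd Γ with
  | bot => simp [h] at hlt
  | top =>
    refine Or.inl ⟨?_, ?_⟩
    · ext β
      exact ⟨fun hβ => (hΓ ▸ hβ : β ∈ {β ∈ canonicalSpace Q | b ≤ β}).2,
        fun hβ => hmem β hβ (h ▸ EReal.coe_lt_top β)⟩
    · rw [toRightEnd, h]
      have : 𝓝[<] (⊤ : EReal) = 𝓝[≠] ⊤ := by
        congr 1
        ext x
        simp [lt_top_iff_ne_top]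
      rw [this, EReal.nhdsWithin_top, comap_map EReal.coe_injective]
  | coe s =>
    rw [h] at hlt hmem hle
    refine Or.inr ⟨s, EReal.coe_lt_coe_iff.1 hlt, fun β hβ => hmem β hβ.1
      (EReal.coe_lt_coe_iff.2 hβ.2), fun β hβ => ⟨(hΓ ▸ hβ : β ∈ {β ∈ canonicalSpace Q | b ≤ β}).2,
        EReal.coe_le_coe_iff.1 (hle β hβ)⟩, ?_⟩
    have hpre : (fun β : ℝ => (β : EReal)) ⁻¹' Set.Iio (s : EReal) = Set.Iio s := by
      ext x
      simp
    rw [toRightEnd, h, nhdsWithin, nhdsWithin, comap_inf, comap_principal, hpre,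
      ← EReal.isEmbedding_coe.nhds_eq_comap]

theorem neBot_toRightEnd (hb : b ∈ interior (canonicalSpace Q))
    (hΓ : Γ = {β ∈ canonicalSpace Q | b ≤ β}) : (toRightEnd Γ).NeBot := by
  rcases leftTruncated_cases hb hΓ with ⟨-, h⟩ | ⟨s, -, -, -, h⟩ <;> rw [h] <;> infer_instance

theorem eventually_mem_toRightEnd (hb : b ∈ interior (canonicalSpace Q))
    (hΓ : Γ = {β ∈ canonicalSpace Q | b ≤ β}) : ∀ᶠ β in toRightEnd Γ, β ∈ Γ := by
  rcases leftTruncated_cases hb hΓ with ⟨h', h⟩ | ⟨s, hs, h', -, h⟩ <;> rw [h]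
  · rw [h']
    exact Ici_mem_atTop b
  · exact mem_of_superset (Ico_mem_nhdsLT hs) h'

/-- The dichotomy behind the theorem: the family is closed at its right end if the parameter set
has a largest element, or if `Q` has an atom at the right end of its support. In the second case
the point mass at this atom plays the role of the missing largest element `P_∞`. -/
def IsClosedAtRightEnd (Q : Measure ℝ) (Γ : Set ℝ) : Prop :=
  (∃ s ∈ Γ, ∀ β ∈ Γ, β ≤ s) ∨ ∃ x₀, Q {x₀} ≠ 0 ∧ Q (Set.Ioi x₀) = 0

end ExpFamily

namespace ExpFamily

variable {Q : Measure ℝ} {Γ : Set ℝ} {b β : ℝ}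

/-! ### Escape of mass when the family is not closed at its right end -/

theorem exists_gt_measure_Ioi_ne_zero {K : ℝ} (hK : Q (Set.Ioi K) ≠ 0) :
    ∃ K', K < K' ∧ Q (Set.Ioi K') ≠ 0 := by
  by_contra! h
  refine hK (measure_mono_null (t := ⋃ n : ℕ, Set.Ioi (K + 1 / ((n : ℝ) + 1))) (fun x hx => ?_)
    (measure_iUnion_null fun n => h _ (lt_add_of_pos_right _ Nat.one_div_pos_of_nat)))
  obtain ⟨n, hn⟩ := exists_nat_one_div_lt (sub_pos.2 (Set.mem_Ioi.1 hx))
  exact Set.mem_iUnion.2 ⟨n, by rw [Set.mem_Ioi]; linarith⟩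

theorem exists_measure_le_of_iInter_null (μ : Measure ℝ) [IsFiniteMeasure μ] {A : ℕ → Set ℝ}
    (hA : ∀ n, MeasurableSet (A n)) (hanti : Antitone A) (hnull : μ (⋂ n, A n) = 0) {ε : ℝ≥0∞}
    (hε : 0 < ε) : ∃ n, μ (A n) ≤ ε := by
  have h := tendsto_measure_iInter_atTop (μ := μ) (fun n => (hA n).nullMeasurableSet) hanti
    ⟨0, measure_ne_top _ _⟩
  rw [hnull] at h
  obtain ⟨n, hn⟩ := (h.eventually (gt_mem_nhds hε)).exists
  exact ⟨n, le_of_lt hn⟩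

/-- If `Q` has no atom at the right end of its support, then a probability measure that is
absolutely continuous with respect to `Q` puts little mass near this end. -/
theorem exists_measure_Ioi_le (hQ : Q ≠ 0) (hatom : ∀ x₀, Q {x₀} ≠ 0 → Q (Set.Ioi x₀) ≠ 0)
    (μ : Measure ℝ) [IsFiniteMeasure μ] (hμ : μ ≪ Q) {ε : ℝ≥0∞} (hε : 0 < ε) :
    ∃ K, Q (Set.Ioi K) ≠ 0 ∧ μ (Set.Ioi K) ≤ ε := by
  by_contra! h
  have hS : ∀ K, μ (Set.Ioi K) ≤ ε → Q (Set.Ioi K) = 0 := fun K hK => by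
    by_contra hne
    exact (h K hne).not_ge hK
  have hne : {K | Q (Set.Ioi K) = 0}.Nonempty := by
    obtain ⟨n, hn⟩ := exists_measure_le_of_iInter_null μ (A := fun n : ℕ => Set.Ioi (n : ℝ))
      (fun _ => measurableSet_Ioi)
      (fun m n hmn => Set.Ioi_subset_Ioi (by exact_mod_cast hmn)) (by
        convert measure_empty (μ := μ)
        ext x
        obtain ⟨n, hn⟩ := exists_nat_ge x
        simpa using ⟨n, hn⟩) hε
    exact ⟨n, hS n hn⟩
  have hbdd : BddBelow {K | Q (Set.Ioi K) = 0} := by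
    by_contra hb
    refine hQ (Measure.measure_univ_eq_zero.1 (measure_mono_null
      (t := ⋃ n : ℕ, Set.Ioi (-(n : ℝ))) (fun x _ => ?_) (measure_iUnion_null fun n => ?_)))
    · obtain ⟨n, hn⟩ := exists_nat_gt (-x)
      exact Set.mem_iUnion.2 ⟨n, by rw [Set.mem_Ioi]; linarith⟩
    · obtain ⟨K, hK, hlt⟩ := not_bddBelow_iff.1 hb (-(n : ℝ))
      exact measure_mono_null (Set.Ioi_subset_Ioi hlt.le) hK
  -- The right end of the support of `Q`.
  set x₀ := sInf {K | Q (Set.Ioi K) = 0} with hx₀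
  have hIoi : Q (Set.Ioi x₀) = 0 := by
    by_contra hne0
    obtain ⟨K', hlt, hK'⟩ := exists_gt_measure_Ioi_ne_zero hne0
    obtain ⟨K, hK, hKlt⟩ := exists_lt_of_csInf_lt hne hlt
    exact hK' (measure_mono_null (Set.Ioi_subset_Ioi hKlt.le) hK)
  have hIci : Q (Set.Ici x₀) = 0 := by
    rw [← Set.Ioi_union_left]
    refine measure_union_null hIoi ?_
    by_contra hne0
    exact hatom x₀ hne0 hIoi
  have hsub : ⋂ n : ℕ, Set.Ioi (x₀ - 1 / ((n : ℝ) + 1)) ⊆ Set.Ici x₀ := fun x hx => by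
    rw [Set.mem_Ici]
    by_contra! hlt
    obtain ⟨n, hn⟩ := exists_nat_one_div_lt (sub_pos.2 hlt)
    have := Set.mem_iInter.1 hx n
    rw [Set.mem_Ioi] at this
    linarith
  obtain ⟨n, hn⟩ := exists_measure_le_of_iInter_null μ
    (A := fun n : ℕ => Set.Ioi (x₀ - 1 / ((n : ℝ) + 1))) (fun _ => measurableSet_Ioi)
    (fun m n hmn => Set.Ioi_subset_Ioi (sub_le_sub_left (Nat.one_div_le_one_div hmn) _))
    (measure_mono_null hsub (hμ hIci)) hε
  exact (csInf_le hbdd (hS _ hn)).not_gt (sub_lt_self _ Nat.one_div_pos_of_nat)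

theorem dist_Iic_le (hQ : Q ≠ 0) (hb : b ∈ canonicalSpace Q) (hβ : β ∈ canonicalSpace Q)
    (hbβ : b ≤ β) (K : ℝ) : dist Q β (Set.Iic K) ≤ ENNReal.ofReal
      (partitionFunction Q b / (partitionFunction Q β * Real.exp (-((β - b) * K)))) := by
  have hZ := partitionFunction_pos hQ hβ
  have hc : 0 ≤ (partitionFunction Q β * Real.exp (-((β - b) * K)))⁻¹ := by positivity
  rw [dist, withDensity_apply _ measurableSet_Iic, div_eq_mul_inv, ENNReal.ofReal_mul' hc,
    ofReal_partitionFunction hb, ← lintegral_mul_const _ (by fun_prop)]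
  refine (setLIntegral_mono' measurableSet_Iic fun x hx => ?_).trans (setLIntegral_le_lintegral _ _)
  rw [density, ← ENNReal.ofReal_mul (Real.exp_nonneg _), mul_inv, ← Real.exp_neg, neg_neg,
    div_eq_mul_inv, mul_left_comm, mul_comm, ← Real.exp_add]
  gcongr
  nlinarith [mul_nonneg (sub_nonneg.2 hbβ) (sub_nonneg.2 (Set.mem_Iic.1 hx))]

/-- By Fatou's lemma, the partition function blows up at a right end `s` of the canonical parameter
space that does not belong to it. -/
theorem tendsto_partitionFunction_nhdsLT {s : ℝ} (hs : s ∉ canonicalSpace Q)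
    (hmem : ∀ᶠ β in 𝓝[<] s, β ∈ canonicalSpace Q) :
    Tendsto (partitionFunction Q) (𝓝[<] s) atTop := by
  rw [← ENNReal.tendsto_ofReal_nhds_top]
  have htop : ∫⁻ x, ENNReal.ofReal (Real.exp (s * x)) ∂Q = ∞ := by
    simpa [canonicalSpace] using hs
  have h : ∞ ≤ liminf (fun β => ∫⁻ x, ENNReal.ofReal (Real.exp (β * x)) ∂Q) (𝓝[<] s) := by
    rw [← htop]
    refine le_trans (le_of_eq ?_) (lintegral_liminf_le fun β => by fun_prop)
    refine lintegral_congr fun x => (Tendsto.liminf_eq ?_).symm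
    have : Continuous fun β : ℝ => ENNReal.ofReal (Real.exp (β * x)) :=
      ENNReal.continuous_ofReal.comp (by fun_prop)
    exact (this.tendsto s).mono_left nhdsWithin_le_nhds
  have := tendsto_of_le_liminf_of_limsup_le h le_top
  refine this.congr' ?_
  filter_upwards [hmem] with β hβ
  exact (ofReal_partitionFunction hβ).symm

/-- If the family is not closed at its right end, then all mass of `P_β` escapes to the right end
of the support of `Q` as `β ↑ β_sup`. -/
theorem tendsto_dist_Iic (hQ : Q ≠ 0) (hb : b ∈ interior (canonicalSpace Q))
    (hΓ : Γ = {β ∈ canonicalSpace Q | b ≤ β}) (hmax : ∀ s ∈ Γ, ∃ β ∈ Γ, s < β)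
    {K : ℝ} (hK : Q (Set.Ioi K) ≠ 0) :
    Tendsto (fun β => dist Q β (Set.Iic K)) (toRightEnd Γ) (𝓝 0) := by
  have hb' := interior_subset hb
  have hev := eventually_mem_toRightEnd hb hΓ
  have hmain : Tendsto (fun β => partitionFunction Q β * Real.exp (-((β - b) * K)))
      (toRightEnd Γ) atTop := by
    rcases leftTruncated_cases hb hΓ with ⟨hΓ', hf⟩ | ⟨s, hbs, hsub, hsup, hf⟩
    · -- The mass of `Q` beyond some `K' > K` makes `Z` grow faster than `exp (β K)`.
      obtain ⟨K', hKK', hK'⟩ := exists_gt_measure_Ioi_ne_zero hK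
      set I := ∫ x in Set.Ioi K', Real.exp (b * x) ∂Q with hI
      have hIpos : 0 < I := by
        have : NeZero (Q.restrict (Set.Ioi K')) :=
          ⟨fun h => hK' (by rw [← Measure.restrict_apply_univ, h]; simp)⟩
        exact integral_exp_pos (integrable_exp hb').integrableOn
      have hlim : Tendsto (fun β => I * Real.exp ((β - b) * (K' - K))) (toRightEnd Γ) atTop := by
        rw [hf]
        exact (Real.tendsto_exp_atTop.comp ((tendsto_atTop_add_const_right _ (-b)
          tendsto_id).atTop_mul_const (sub_pos.2 hKK'))).const_mul_atTop hIpos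
      refine tendsto_atTop_mono' _ ?_ hlim
      filter_upwards [hev] with β hβ
      rw [hΓ] at hβ
      calc I * Real.exp ((β - b) * (K' - K))
          = (∫ x in Set.Ioi K', Real.exp (b * x) * Real.exp ((β - b) * K') ∂Q)
              * Real.exp (-((β - b) * K)) := by
            rw [integral_mul_const, mul_assoc, ← Real.exp_add, ← hI]
            ring_nf
        _ ≤ (∫ x in Set.Ioi K', Real.exp (β * x) ∂Q) * Real.exp (-((β - b) * K)) := by
            refine mul_le_mul_of_nonneg_right (setIntegral_mono_on
              ((integrable_exp hb').mul_const _).integrableOn (integrable_exp hβ.1).integrableOn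
              measurableSet_Ioi fun x hx => ?_) (Real.exp_nonneg _)
            rw [← Real.exp_add]
            refine Real.exp_le_exp.2 ?_
            nlinarith [mul_nonneg (sub_nonneg.2 hβ.2) (sub_nonneg.2 (le_of_lt hx))]
        _ ≤ _ := mul_le_mul_of_nonneg_right (setIntegral_le_integral (integrable_exp hβ.1)
            (ae_of_all _ fun _ => Real.exp_nonneg _)) (Real.exp_nonneg _)
    · rw [hf] at hev ⊢
      have hs : s ∉ canonicalSpace Q := fun hs => by
        obtain ⟨β, hβ, hlt⟩ := hmax s (hΓ ▸ ⟨hs, hbs.le⟩)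
        exact (hsup hβ).2.not_gt hlt
      have hc : Continuous fun β : ℝ => Real.exp (-((β - b) * K)) := by fun_prop
      refine (tendsto_partitionFunction_nhdsLT hs ?_).atTop_mul_pos (Real.exp_pos _)
        ((hc.tendsto s).mono_left nhdsWithin_le_nhds)
      filter_upwards [hev] with β hβ
      rw [hΓ] at hβ
      exact hβ.1
  refine tendsto_of_tendsto_of_tendsto_of_le_of_le' tendsto_const_nhds
    (h := fun β => ENNReal.ofReal
      (partitionFunction Q b / (partitionFunction Q β * Real.exp (-((β - b) * K))))) ?_
    (Eventually.of_forall fun _ => zero_le) ?_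
  · rw [← ENNReal.ofReal_zero]
    exact ENNReal.tendsto_ofReal (tendsto_const_nhds.div_atTop hmain)
  · filter_upwards [hev] with β hβ
    rw [hΓ] at hβ
    exact dist_Iic_le hQ hb' hβ.1 hβ.2 K

theorem not_isClosedAtRightEnd_iff : ¬ IsClosedAtRightEnd Q Γ ↔
    (∀ s ∈ Γ, ∃ β ∈ Γ, s < β) ∧ ∀ x₀, Q {x₀} ≠ 0 → Q (Set.Ioi x₀) ≠ 0 := by
  unfold IsClosedAtRightEnd
  push Not
  rfl

/-- If the family is not closed at its right end, then one can choose parameters successively such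
that each `P_β` lives mostly to the right of where its predecessors live. -/
theorem exists_concentrating_seq (hQ : Q ≠ 0) (hb : b ∈ interior (canonicalSpace Q))
    (hΓ : Γ = {β ∈ canonicalSpace Q | b ≤ β}) (hbad : ¬ IsClosedAtRightEnd Q Γ)
    {p : ℝ → Prop} (hp : ∀ᶠ β in toRightEnd Γ, p β) :
    ∃ β K : ℕ → ℝ, Monotone K ∧ ∀ n, β n ∈ Γ ∧ p (β n) ∧
      (1 / 2 : ℝ≥0∞) ≤ dist Q (β n) (Set.Ioc (K n) (K (n + 1))) := by
  obtain ⟨hmax, hatom⟩ := not_isClosedAtRightEnd_iff.1 hbad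
  have := neBot_toRightEnd hb hΓ
  have hstep : ∀ K : {K // Q (Set.Ioi K) ≠ 0}, ∃ (K' : {K // Q (Set.Ioi K) ≠ 0}) (β : ℝ),
      β ∈ Γ ∧ p β ∧ (1 / 2 : ℝ≥0∞) ≤ dist Q β (Set.Ioc K K') := by
    rintro ⟨K, hK⟩
    have h4 : (0 : ℝ≥0∞) < 1 / 4 := by simp
    obtain ⟨β, hβΓ, hpβ, hβ⟩ := ((eventually_mem_toRightEnd hb hΓ).and (hp.and
      ((tendsto_dist_Iic hQ hb hΓ hmax hK).eventually (gt_mem_nhds h4)))).exists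
    have : IsProbabilityMeasure (dist Q β) :=
      isProbabilityMeasure_dist hQ (hΓ ▸ hβΓ : β ∈ {β ∈ canonicalSpace Q | b ≤ β}).1
    obtain ⟨K', hK', hle⟩ := exists_measure_Ioi_le hQ hatom (dist Q β)
      (withDensity_absolutelyContinuous _ _) h4
    refine ⟨⟨K', hK'⟩, β, hβΓ, hpβ, ?_⟩
    have hcover : 1 ≤ dist Q β (Set.Ioc K K') + (1 / 4 + 1 / 4) := by
      calc 1 = dist Q β Set.univ := measure_univ.symm
        _ ≤ dist Q β (Set.Ioc K K' ∪ (Set.Iic K ∪ Set.Ioi K')) := by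
            refine measure_mono fun x _ => ?_
            simp only [Set.mem_union, Set.mem_Ioc, Set.mem_Iic, Set.mem_Ioi]
            grind
        _ ≤ _ := (measure_union_le _ _).trans
            (add_le_add le_rfl ((measure_union_le _ _).trans (add_le_add hβ.le hle)))
    have hq : (1 / 4 + 1 / 4 : ℝ≥0∞) = 1 / 2 := by
      rw [← ENNReal.toReal_eq_toReal_iff' (by simp) (by simp)]
      rw [ENNReal.toReal_add (by simp) (by simp)]
      norm_num
    rw [hq] at hcover
    refine (ENNReal.add_le_add_iff_right (a := 1 / 2) (by simp)).1 ?_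
    rwa [ENNReal.add_halves]
  choose next β hβΓ hβp hβ using hstep
  have : IsProbabilityMeasure (dist Q b) := isProbabilityMeasure_dist hQ (interior_subset hb)
  obtain ⟨K₀, hK₀, -⟩ := exists_measure_Ioi_le hQ hatom (dist Q b)
    (withDensity_absolutelyContinuous _ _) one_pos
  let K : ℕ → {K // Q (Set.Ioi K) ≠ 0} := fun n => next^[n] ⟨K₀, hK₀⟩
  have hK : ∀ n, (1 / 2 : ℝ≥0∞) ≤ dist Q (β (K n)) (Set.Ioc (K n : ℝ) (K (n + 1))) := fun n => by
    have := hβ (K n)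
    rwa [show next (K n) = K (n + 1) from (Function.iterate_succ_apply' next n _).symm] at this
  refine ⟨fun n => β (K n), fun n => K n, monotone_nat_of_le_succ fun n => ?_,
    fun n => ⟨hβΓ _, hβp _, hK n⟩⟩
  by_contra! hlt
  have := hK n
  rw [Set.Ioc_eq_empty (not_lt.2 hlt.le), measure_empty] at this
  simp at this

/-! ### Finite divergences force the family to be closed at its right end -/

theorem exists_nat_lt_ofReal_log {C : ℝ≥0∞} (hC : C ≠ ∞) :
    ∃ n : ℕ, 0 < n ∧ C < ENNReal.ofReal (Real.log n / 2) := by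
  have h : Tendsto (fun n : ℕ => ENNReal.ofReal (Real.log n / 2)) atTop (𝓝 ∞) :=
    ENNReal.tendsto_ofReal_nhds_top.2
      ((Real.tendsto_log_atTop.comp tendsto_natCast_atTop_atTop).atTop_div_const (by norm_num))
  obtain ⟨n, hn, hlt⟩ := ((eventually_gt_atTop 0).and
    (h.eventually (lt_mem_nhds hC.lt_top))).exists
  exact ⟨n, hn, hlt⟩

/-- A family is closed at its right end if any finitely many parameters near this end have bounded
average divergence from some common distribution `R`. The choice of `R` may depend on the
parameters, as it does for output distributions of the channel; the property `p` allows one to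
restrict to parameters near the end. -/
theorem isClosedAtRightEnd_of_sum_klDiv_le (hQ : Q ≠ 0) (hb : b ∈ interior (canonicalSpace Q))
    (hΓ : Γ = {β ∈ canonicalSpace Q | b ≤ β}) {p : ℝ → Prop} (hp : ∀ᶠ β in toRightEnd Γ, p β)
    {C : ℝ≥0∞} (hC : C ≠ ∞)
    (h : ∀ (n : ℕ) (β : Fin n → ℝ), 0 < n → (∀ i, β i ∈ Γ) → (∀ i, p (β i)) →
      ∃ R : Measure ℝ, IsProbabilityMeasure R ∧
        ∑ i, InformationTheory.klDiv (dist Q (β i)) R ≤ n * C) :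
    IsClosedAtRightEnd Q Γ := by
  by_contra hbad
  obtain ⟨β, K, hK, hβ⟩ := exists_concentrating_seq hQ hb hΓ hbad hp
  obtain ⟨n, hn, hlt⟩ := exists_nat_lt_ofReal_log (ENNReal.add_ne_top.2 ⟨hC, ENNReal.one_ne_top⟩)
  obtain ⟨R, hR, hle⟩ := h n (fun i => β i) hn (fun i => (hβ i).1) fun i => (hβ i).2.1
  have : ∀ i : Fin n, IsProbabilityMeasure (dist Q (β i)) := fun i =>
    isProbabilityMeasure_dist hQ (hΓ ▸ (hβ i).1 : β i ∈ {β ∈ canonicalSpace Q | b ≤ β}).1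
  have hlog := mul_log_le_sum_klDiv (fun i : Fin n => dist Q (β i)) R
    (fun i => Set.Ioc (K i) (K (i + 1))) (fun _ => measurableSet_Ioc)
    (fun i j hij => hK.pairwise_disjoint_on_Ioc_succ (Fin.val_injective.ne hij))
    fun i => (hβ i).2.2
  have hle' : (n : ℝ≥0∞) * ENNReal.ofReal (Real.log n / 2) ≤ n * (C + 1) := by
    refine hlog.trans ?_
    rw [mul_add, mul_one]
    gcongr
  exact hlt.not_ge ((ENNReal.mul_le_mul_iff_right (by simpa using hn.ne') (by simp)).1 hle')

theorem isClosedAtRightEnd_of_klDiv_le (hQ : Q ≠ 0) (hb : b ∈ interior (canonicalSpace Q))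
    (hΓ : Γ = {β ∈ canonicalSpace Q | b ≤ β}) (R : Measure ℝ) [IsProbabilityMeasure R]
    {C : ℝ≥0∞} (hC : C ≠ ∞)
    (h : ∀ᶠ β in toRightEnd Γ, InformationTheory.klDiv (dist Q β) R ≤ C) :
    IsClosedAtRightEnd Q Γ :=
  isClosedAtRightEnd_of_sum_klDiv_le hQ hb hΓ h hC fun n _ _ _ hβ => ⟨R, inferInstance,
    (Finset.sum_le_sum fun i _ => hβ i).trans_eq (by simp)⟩

theorem isClosedAtRightEnd_of_capacity_lt_top (hQ : Q ≠ 0) (hb : b ∈ interior (canonicalSpace Q))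
    (hΓ : Γ = {β ∈ canonicalSpace Q | b ≤ β}) (h : capacity Q Γ < ∞) :
    IsClosedAtRightEnd Q Γ := by
  refine isClosedAtRightEnd_of_sum_klDiv_le hQ hb hΓ (p := fun _ => True)
    (Eventually.of_forall fun _ => trivial) h.ne fun n β hn hβ _ => ?_
  -- The input distribution is uniform on the `n` parameters.
  let π : Measure Γ := (n : ℝ≥0∞)⁻¹ • ∑ i, Measure.dirac (⟨β i, hβ i⟩ : Γ)
  have hn0 : (n : ℝ≥0∞) ≠ 0 := by simpa using hn.ne'
  have hπ : IsProbabilityMeasure π := ⟨by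
    simp [π, ENNReal.inv_mul_cancel hn0 (ENNReal.natCast_ne_top n)]⟩
  have hmeas : Measurable fun β : Γ => dist Q β :=
    (measurable_dist (interior_subset hb)).comp measurable_subtype_coe
  refine ⟨outputDist Q Γ π, isProbabilityMeasure_bind hmeas.aemeasurable (ae_of_all _ fun β =>
    isProbabilityMeasure_dist hQ (hΓ ▸ β.2 : (β : ℝ) ∈ {β ∈ canonicalSpace Q | b ≤ β}).1), ?_⟩
  have hmi : (n : ℝ≥0∞) * mutualInfo Q Γ π =
      ∑ i, InformationTheory.klDiv (dist Q (β i)) (outputDist Q Γ π) := by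
    rw [mutualInfo]
    conv_lhs => rw [show (∫⁻ β : Γ, InformationTheory.klDiv (dist Q β) (outputDist Q Γ π) ∂π)
      = (n : ℝ≥0∞)⁻¹ * ∑ i, InformationTheory.klDiv (dist Q (β i)) (outputDist Q Γ π) by
        conv_lhs => enter [1]; change (n : ℝ≥0∞)⁻¹ • ∑ i, Measure.dirac (⟨β i, hβ i⟩ : Γ)
        rw [lintegral_smul_measure, lintegral_finsetSum_measure]
        simp only [lintegral_dirac, smul_eq_mul]]
    rw [← mul_assoc, ENNReal.mul_inv_cancel hn0 (ENNReal.natCast_ne_top n), one_mul]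
  rw [← hmi]
  gcongr
  exact le_iSup₂_of_le π hπ le_rfl

theorem isClosedAtRightEnd_of_tendsto_klDiv_left (hQ : Q ≠ 0)
    (hb : b ∈ interior (canonicalSpace Q)) (hΓ : Γ = {β ∈ canonicalSpace Q | b ≤ β}) {β₀ : ℝ}
    (hβ₀ : β₀ ∈ Γ) {l : ℝ≥0} (h : Tendsto (fun β => InformationTheory.klDiv (dist Q β₀) (dist Q β))
      (toRightEnd Γ) (𝓝 (l : ℝ≥0∞))) : IsClosedAtRightEnd Q Γ := by
  by_contra hbad
  obtain ⟨hmax, hatom⟩ := not_isClosedAtRightEnd_iff.1 hbad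
  have := neBot_toRightEnd hb hΓ
  have : IsProbabilityMeasure (dist Q β₀) :=
    isProbabilityMeasure_dist hQ (hΓ ▸ hβ₀ : β₀ ∈ {β ∈ canonicalSpace Q | b ≤ β}).1
  obtain ⟨K, hK, hle⟩ := exists_measure_Ioi_le hQ hatom (dist Q β₀)
    (withDensity_absolutelyContinuous _ _) (ε := 1 / 2) (by simp)
  have hhalf : (1 / 2 : ℝ≥0∞) ≤ dist Q β₀ (Set.Iic K) := by
    refine (ENNReal.add_le_add_iff_right (a := 1 / 2) (by simp)).1 ?_
    calc (1 / 2 + 1 / 2 : ℝ≥0∞) = dist Q β₀ (Set.Iic K ∪ Set.Ioi K) := by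
          rw [ENNReal.add_halves, Set.Iic_union_Ioi, measure_univ]
      _ ≤ _ := (measure_union_le _ _).trans (add_le_add le_rfl hle)
  set t : ℝ := 2 * l + 2 with ht
  have hlim : Tendsto (fun β => InformationTheory.klDiv (dist Q β₀) (dist Q β)
      + ENNReal.ofReal (Real.exp t - 1) * dist Q β (Set.Iic K)) (toRightEnd Γ)
      (𝓝 (l + ENNReal.ofReal (Real.exp t - 1) * 0)) :=
    h.add (ENNReal.Tendsto.const_mul (tendsto_dist_Iic hQ hb hΓ hmax hK)
      (Or.inr ENNReal.ofReal_ne_top))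
  have hge := ge_of_tendsto hlim (b := ENNReal.ofReal t * (1 / 2)) (by
    filter_upwards [eventually_mem_toRightEnd hb hΓ] with β hβ
    have : IsProbabilityMeasure (dist Q β) :=
      isProbabilityMeasure_dist hQ (hΓ ▸ hβ : β ∈ {β ∈ canonicalSpace Q | b ≤ β}).1
    refine le_trans ?_ (mul_measure_le_klDiv_add (dist Q β₀) (dist Q β) (Set.Iic K)
      (by positivity))
    gcongr)
  have hval : ENNReal.ofReal t * (1 / 2) = l + 1 := by
    rw [ht, ENNReal.ofReal_add (by positivity) (by norm_num), add_mul,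
      ENNReal.ofReal_mul (by norm_num), ENNReal.ofReal_coe_nnreal, mul_right_comm]
    simp [ENNReal.mul_inv_cancel]
  rw [hval, mul_zero, add_zero] at hge
  exact (ENNReal.lt_add_right ENNReal.coe_ne_top one_ne_zero).not_ge hge

end ExpFamily

namespace ExpFamily

variable {Q : Measure ℝ} {Γ : Set ℝ} {b β s : ℝ}

/-! ### Families that are closed at their right end -/

theorem exists_lt_mem_canonicalSpace (hb : b ∈ interior (canonicalSpace Q)) :
    ∃ b' < b, b' ∈ canonicalSpace Q := by
  obtain ⟨c, hc, hlt⟩ := ((show ∀ᶠ x in 𝓝[<] b, x ∈ canonicalSpace Q from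
    nhdsWithin_le_nhds (mem_interior_iff_mem_nhds.1 hb)).and self_mem_nhdsWithin).exists
  exact ⟨c, hlt, hc⟩

theorem mem_interior_canonicalSpace (hb : b ∈ interior (canonicalSpace Q))
    (hs : s ∈ canonicalSpace Q) (hbβ : b ≤ β) (hβs : β < s) :
    β ∈ interior (canonicalSpace Q) := by
  obtain ⟨b', hlt, hb'⟩ := exists_lt_mem_canonicalSpace hb
  exact mem_interior_iff_mem_nhds.2 (mem_of_superset (Ioo_mem_nhds (hlt.trans_le hbβ) hβs)
    fun x hx => mem_canonicalSpace_of_le_of_le hb' hs hx.1.le hx.2.le)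

theorem exists_pos_le_partitionFunction (hQ : Q ≠ 0) (hb : b ∈ canonicalSpace Q)
    (hs : s ∈ canonicalSpace Q) :
    ∃ z, 0 < z ∧ ∀ β, b ≤ β → β ≤ s → z ≤ partitionFunction Q β := by
  have hpt : ∀ β, b ≤ β → β ≤ s → ∀ x, Real.exp (min (b * x) (s * x)) ≤ Real.exp (β * x) := by
    intro β hbβ hβs x
    refine Real.exp_le_exp.2 ?_
    rcases le_total 0 x with hx | hx
    · exact (min_le_left _ _).trans (mul_le_mul_of_nonneg_right hbβ hx)
    · exact (min_le_right _ _).trans (mul_le_mul_of_nonpos_right hβs hx)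
  have hint : Integrable (fun x => Real.exp (min (b * x) (s * x))) Q := by
    refine (integrable_exp hb).mono' (by fun_prop) (ae_of_all _ fun x => ?_)
    rw [Real.norm_of_nonneg (Real.exp_nonneg _)]
    exact Real.exp_le_exp.2 (min_le_left _ _)
  have : NeZero Q := ⟨hQ⟩
  refine ⟨_, integral_exp_pos hint, fun β hbβ hβs => ?_⟩
  exact integral_mono hint (integrable_exp (mem_canonicalSpace_of_le_of_le hb hs hbβ hβs))
    (hpt β hbβ hβs)

theorem exp_mul_le_add (hbβ : b ≤ β) (hβs : β ≤ s) (x : ℝ) :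
    Real.exp (β * x) ≤ Real.exp (b * x) + Real.exp (s * x) := by
  rcases le_total 0 x with hx | hx
  · have := Real.exp_le_exp.2 (mul_le_mul_of_nonneg_right hβs hx)
    linarith [Real.exp_pos (b * x)]
  · have := Real.exp_le_exp.2 (mul_le_mul_of_nonpos_right hbβ hx)
    linarith [Real.exp_pos (s * x)]

theorem exists_density_le_of_le (hQ : Q ≠ 0) (hb : b ∈ canonicalSpace Q)
    (hs : s ∈ canonicalSpace Q) : ∃ c : ℝ≥0∞, c ≠ ∞ ∧ ∀ β, b ≤ β → β ≤ s → ∀ x,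
      density Q β x ≤ c * (density Q b x + density Q s x) := by
  obtain ⟨z, hz, hle⟩ := exists_pos_le_partitionFunction hQ hb hs
  have hZb := partitionFunction_pos hQ hb
  have hZs := partitionFunction_pos hQ hs
  refine ⟨ENNReal.ofReal ((partitionFunction Q b + partitionFunction Q s) / z),
    ENNReal.ofReal_ne_top, fun β hbβ hβs x => ?_⟩
  rw [density, density, density, ← ENNReal.ofReal_add (by positivity) (by positivity),
    ← ENNReal.ofReal_mul (by positivity)]
  refine ENNReal.ofReal_le_ofReal ?_
  calc Real.exp (β * x) / partitionFunction Q β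
      ≤ (Real.exp (b * x) + Real.exp (s * x)) / z :=
        div_le_div₀ (by positivity) (exp_mul_le_add hbβ hβs x) hz (hle β hbβ hβs)
    _ = (partitionFunction Q b * (Real.exp (b * x) / partitionFunction Q b)
          + partitionFunction Q s * (Real.exp (s * x) / partitionFunction Q s)) / z := by
        field_simp
    _ ≤ ((partitionFunction Q b + partitionFunction Q s)
          * (Real.exp (b * x) / partitionFunction Q b)
          + (partitionFunction Q b + partitionFunction Q s)
          * (Real.exp (s * x) / partitionFunction Q s)) / z := by
        gcongr <;> linarith
    _ = _ := by ring

variable {x₀ : ℝ}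

theorem ae_le_of_measure_Ioi (h : Q (Set.Ioi x₀) = 0) : ∀ᵐ x ∂Q, x ≤ x₀ := by
  rw [ae_iff]
  simpa [Set.Ioi] using h

theorem mem_canonicalSpace_of_measure_Ioi (hb : b ∈ canonicalSpace Q)
    (h : Q (Set.Ioi x₀) = 0) (hbβ : b ≤ β) : β ∈ canonicalSpace Q := by
  rw [canonicalSpace_eq_integrableExpSet]
  refine ((integrable_exp hb).mul_const (Real.exp ((β - b) * x₀))).mono' (by fun_prop) ?_
  filter_upwards [ae_le_of_measure_Ioi h] with x hx
  rw [Real.norm_of_nonneg (Real.exp_nonneg _), ← Real.exp_add]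
  refine Real.exp_le_exp.2 ?_
  simp only [id]
  nlinarith [mul_nonneg (sub_nonneg.2 hbβ) (sub_nonneg.2 hx)]

/-- If `Q` has an atom at the right end `x₀` of its support, then `Z β ≥ exp (β x₀) Q {x₀}`, and
this makes all densities comparable to the one for `b`. -/
theorem exists_density_le_of_atom (hQ : Q ≠ 0) (hb : b ∈ canonicalSpace Q)
    (hatom : Q {x₀} ≠ 0) (h : Q (Set.Ioi x₀) = 0) : ∃ c : ℝ≥0∞, c ≠ ∞ ∧
      ∀ᵐ x ∂Q, ∀ β, b ≤ β → density Q β x ≤ c * density Q b x := by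
  have hZb := partitionFunction_pos hQ hb
  have hZ : ∀ β, b ≤ β → ENNReal.ofReal (Real.exp (β * x₀)) * Q {x₀} ≤
      ENNReal.ofReal (partitionFunction Q β) := fun β hbβ => by
    rw [ofReal_partitionFunction (mem_canonicalSpace_of_measure_Ioi hb h hbβ)]
    refine le_trans (le_of_eq ?_) (setLIntegral_le_lintegral {x₀} _)
    rw [lintegral_singleton]
  have hfin : Q {x₀} ≠ ∞ := fun htop => by
    have := hZ b le_rfl
    rw [htop, ENNReal.mul_top (by simpa using Real.exp_pos _)] at this
    exact ENNReal.ofReal_ne_top (top_le_iff.1 this)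
  set q := (Q {x₀}).toReal with hq
  have hqpos : 0 < q := ENNReal.toReal_pos hatom hfin
  have hZ' : ∀ β, b ≤ β → Real.exp (β * x₀) * q ≤ partitionFunction Q β := fun β hbβ => by
    have := hZ β hbβ
    rw [← ENNReal.ofReal_toReal hfin, ← ENNReal.ofReal_mul (Real.exp_nonneg _)] at this
    exact (ENNReal.ofReal_le_ofReal_iff (partitionFunction_pos hQ
      (mem_canonicalSpace_of_measure_Ioi hb h hbβ)).le).1 this
  refine ⟨ENNReal.ofReal (partitionFunction Q b * (Real.exp (-(b * x₀)) / q)),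
    ENNReal.ofReal_ne_top, ?_⟩
  filter_upwards [ae_le_of_measure_Ioi h] with x hx β hbβ
  rw [density, density, ← ENNReal.ofReal_mul (by positivity)]
  refine ENNReal.ofReal_le_ofReal ?_
  calc Real.exp (β * x) / partitionFunction Q β
      ≤ Real.exp (β * x) / (Real.exp (β * x₀) * q) := by
        gcongr
        exact hZ' β hbβ
    _ = Real.exp (β * x - β * x₀) / q := by rw [Real.exp_sub, div_div]
    _ ≤ Real.exp (b * x - b * x₀) / q := by
        refine div_le_div_of_nonneg_right (Real.exp_le_exp.2 ?_) hqpos.le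
        nlinarith [mul_nonneg (sub_nonneg.2 hbβ) (sub_nonneg.2 hx)]
    _ = _ := by
        rw [sub_eq_add_neg, Real.exp_add]
        field_simp

theorem measurable_maxLikelihood (Q : Measure ℝ) (Γ : Set ℝ) :
    Measurable (maxLikelihood Q Γ) := by
  refine LowerSemicontinuous.measurable ?_
  refine lowerSemicontinuous_biSup fun β _ => Continuous.lowerSemicontinuous ?_
  unfold density
  exact ENNReal.continuous_ofReal.comp (by fun_prop)

theorem shtarkov_lt_top_of_isClosedAtRightEnd (hQ : Q ≠ 0) (hb : b ∈ interior (canonicalSpace Q))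
    (hΓ : Γ = {β ∈ canonicalSpace Q | b ≤ β}) (h : IsClosedAtRightEnd Q Γ) :
    shtarkov Q Γ < ∞ := by
  have hb' := interior_subset hb
  rcases h with ⟨s, hs, hmax⟩ | ⟨x₀, hatom, h0⟩
  · have hsc : s ∈ canonicalSpace Q := (hΓ ▸ hs : s ∈ {β ∈ canonicalSpace Q | b ≤ β}).1
    obtain ⟨c, hc, hle⟩ := exists_density_le_of_le hQ hb' hsc
    calc shtarkov Q Γ ≤ ∫⁻ x, c * (density Q b x + density Q s x) ∂Q :=
          lintegral_mono fun x => iSup₂_le fun β hβ =>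
            hle β (hΓ ▸ hβ : β ∈ {β ∈ canonicalSpace Q | b ≤ β}).2 (hmax β hβ) x
      _ = c * (1 + 1) := by
          rw [lintegral_const_mul' _ _ hc, lintegral_add_left (measurable_density Q b),
            lintegral_density hQ hb', lintegral_density hQ hsc]
      _ < ∞ := ENNReal.mul_lt_top hc.lt_top (by simp)
  · obtain ⟨c, hc, hle⟩ := exists_density_le_of_atom hQ hb' hatom h0
    calc shtarkov Q Γ ≤ ∫⁻ x, c * density Q b x ∂Q := by
          refine lintegral_mono_ae ?_
          filter_upwards [hle] with x hx
          exact iSup₂_le fun β hβ => hx β (hΓ ▸ hβ : β ∈ {β ∈ canonicalSpace Q | b ≤ β}).2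
      _ = c := by rw [lintegral_const_mul' _ _ hc, lintegral_density hQ hb', mul_one]
      _ < ∞ := hc.lt_top

/-- If the parameter set has a largest element `s`, then `D(P_β ‖ P_s)` is bounded: the mean of
`P_β` is bounded below, since `D(P_β ‖ P_b') ≥ 0` for a parameter `b' < b`. -/
theorem exists_klDiv_le_of_max (hQ : Q ≠ 0) (hb : b ∈ interior (canonicalSpace Q))
    (hs : s ∈ canonicalSpace Q) : ∃ C : ℝ≥0∞, C ≠ ∞ ∧ ∀ β, b ≤ β → β ≤ s →
      InformationTheory.klDiv (dist Q β) (dist Q s) ≤ C := by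
  obtain ⟨b', hlt, hb'⟩ := exists_lt_mem_canonicalSpace hb
  obtain ⟨z, hz, hle⟩ := exists_pos_le_partitionFunction hQ hb' hs
  set L := Real.log (partitionFunction Q b') - Real.log z with hL
  refine ⟨ENNReal.ofReal ((s - b) * (L / (b - b')) - Real.log z
    + Real.log (partitionFunction Q s)), ENNReal.ofReal_ne_top, fun β hbβ hβs => ?_⟩
  have hβc := mem_canonicalSpace_of_le_of_le hb' hs (hlt.le.trans hbβ) hβs
  rcases hβs.eq_or_lt with rfl | hβs'
  · have := isProbabilityMeasure_dist hQ hs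
    rw [InformationTheory.klDiv_self]
    exact zero_le
  · have hint := integrable_id_dist (mem_interior_canonicalSpace hb hs hbβ hβs')
    rw [(klDiv_dist hQ hβc hs hint).1]
    have hnonneg := (klDiv_dist hQ hβc hb' hint).2
    set μ := ∫ x, x ∂dist Q β
    refine ENNReal.ofReal_le_ofReal ?_
    have hlogβ : Real.log z ≤ Real.log (partitionFunction Q β) :=
      Real.log_le_log hz (hle β (hlt.le.trans hbβ) hβs)
    have hLnonneg : 0 ≤ L := sub_nonneg.2 (Real.log_le_log hz (hle b' le_rfl
      (hlt.le.trans (hbβ.trans hβs))))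
    have hbb' : 0 < b - b' := sub_pos.2 hlt
    have hmean : (s - β) * -μ ≤ (s - b) * (L / (b - b')) := by
      rcases le_total 0 μ with hμ | hμ
      · have h1 : (s - β) * -μ ≤ 0 := by
          nlinarith [mul_nonneg (sub_nonneg.2 hβs) hμ]
        have h2 : 0 ≤ (s - b) * (L / (b - b')) :=
          mul_nonneg (sub_nonneg.2 (hbβ.trans hβs)) (by positivity)
        exact h1.trans h2
      · have h1 : -μ ≤ L / (b - b') := by
          rw [le_div_iff₀ hbb']
          nlinarith [mul_nonneg (sub_nonneg.2 hbβ) (neg_nonneg.2 hμ)]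
        exact mul_le_mul (by linarith) h1 (neg_nonneg.2 hμ) (sub_nonneg.2 (hbβ.trans hβs))
    linarith

theorem exists_klDiv_le_of_atom (hQ : Q ≠ 0) (hb : b ∈ canonicalSpace Q)
    (hatom : Q {x₀} ≠ 0) (h : Q (Set.Ioi x₀) = 0) : ∃ C : ℝ≥0∞, C ≠ ∞ ∧ ∀ β, b ≤ β →
      InformationTheory.klDiv (dist Q β) (dist Q b) ≤ C := by
  obtain ⟨c, hc, hle⟩ := exists_density_le_of_atom hQ hb hatom h
  refine ⟨c + 1, ENNReal.add_ne_top.2 ⟨hc, ENNReal.one_ne_top⟩, fun β hbβ => ?_⟩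
  have hβ := mem_canonicalSpace_of_measure_Ioi hb h hbβ
  have : IsProbabilityMeasure (Q.withDensity (density Q b)) := isProbabilityMeasure_dist hQ hb
  have : IsProbabilityMeasure (Q.withDensity (density Q β)) := isProbabilityMeasure_dist hQ hβ
  refine (klDiv_withDensity_le Q (measurable_density Q β) (measurable_density Q b)
    (ae_of_all _ (density_ne_zero hQ hb)) (ae_of_all _ (density_ne_top Q b))).trans ?_
  gcongr
  calc ∫⁻ x, density Q β x * (density Q β x / density Q b x) ∂Q
      ≤ ∫⁻ x, density Q β x * c ∂Q := by
        refine lintegral_mono_ae ?_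
        filter_upwards [hle] with x hx
        gcongr
        exact ENNReal.div_le_of_le_mul (hx β hbβ)
    _ = c := by rw [lintegral_mul_const' _ _ hc, lintegral_density hQ hβ, one_mul]

theorem exists_iSup_klDiv_lt_top_of_isClosedAtRightEnd (hQ : Q ≠ 0)
    (hb : b ∈ interior (canonicalSpace Q)) (hΓ : Γ = {β ∈ canonicalSpace Q | b ≤ β})
    (h : IsClosedAtRightEnd Q Γ) : ∃ β₁ ∈ Γ,
      (⨆ β ∈ Γ, InformationTheory.klDiv (dist Q β) (dist Q β₁)) < ∞ := by
  have hΓ₂ : ∀ β ∈ Γ, β ∈ canonicalSpace Q ∧ b ≤ β := fun β hβ => by rwa [hΓ] at hβ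
  rcases h with ⟨s, hs, hmax⟩ | ⟨x₀, hatom, h0⟩
  · obtain ⟨C, hC, hle⟩ := exists_klDiv_le_of_max hQ hb (hΓ₂ s hs).1
    exact ⟨s, hs, (iSup₂_le fun β hβ => hle β (hΓ₂ β hβ).2 (hmax β hβ)).trans_lt hC.lt_top⟩
  · obtain ⟨C, hC, hle⟩ := exists_klDiv_le_of_atom hQ (interior_subset hb) hatom h0
    exact ⟨b, hΓ ▸ ⟨interior_subset hb, le_rfl⟩,
      (iSup₂_le fun β hβ => hle β (hΓ₂ β hβ).2).trans_lt hC.lt_top⟩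

theorem tendsto_partitionFunction_of_mem (hb : b ∈ canonicalSpace Q) (hs : s ∈ canonicalSpace Q)
    (hbs : b < s) :
    Tendsto (partitionFunction Q) (𝓝[<] s) (𝓝 (partitionFunction Q s)) := by
  refine tendsto_integral_filter_of_dominated_convergence
    (fun x => Real.exp (b * x) + Real.exp (s * x)) (Eventually.of_forall fun β => by fun_prop) ?_
    ((integrable_exp hb).add (integrable_exp hs)) (ae_of_all _ fun x => ?_)
  · filter_upwards [Ico_mem_nhdsLT hbs] with β hβ
    refine ae_of_all _ fun x => ?_
    rw [Real.norm_of_nonneg (Real.exp_nonneg _)]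
    exact exp_mul_le_add hβ.1 hβ.2.le x
  · have : Continuous fun β : ℝ => Real.exp (β * x) := by fun_prop
    exact (this.tendsto s).mono_left nhdsWithin_le_nhds

theorem exists_tendsto_klDiv_left_of_max (hQ : Q ≠ 0) (hb : b ∈ interior (canonicalSpace Q))
    (hs : s ∈ canonicalSpace Q) (hbs : b < s) : ∃ l : ℝ≥0, Tendsto
      (fun β => InformationTheory.klDiv (dist Q b) (dist Q β)) (𝓝[<] s) (𝓝 (l : ℝ≥0∞)) := by
  have hb' := interior_subset hb
  refine ⟨((b - s) * (∫ x, x ∂dist Q b) - Real.log (partitionFunction Q b)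
    + Real.log (partitionFunction Q s)).toNNReal, ?_⟩
  have hlim : Tendsto (fun β => (b - β) * (∫ x, x ∂dist Q b) - Real.log (partitionFunction Q b)
      + Real.log (partitionFunction Q β)) (𝓝[<] s) (𝓝 ((b - s) * (∫ x, x ∂dist Q b)
        - Real.log (partitionFunction Q b) + Real.log (partitionFunction Q s))) := by
    have hid : Tendsto (fun β : ℝ => β) (𝓝[<] s) (𝓝 s) := tendsto_id.mono_left nhdsWithin_le_nhds
    exact (((tendsto_const_nhds.sub hid).mul_const _).sub_const _).add
      ((tendsto_partitionFunction_of_mem hb' hs hbs).log (partitionFunction_pos hQ hs).ne')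
  refine (ENNReal.tendsto_ofReal hlim).congr' ?_
  filter_upwards [Ico_mem_nhdsLT hbs] with β hβ
  exact (klDiv_dist hQ hb' (mem_canonicalSpace_of_le_of_le hb' hs hβ.1 hβ.2.le)
    (integrable_id_dist hb)).1.symm

/-- The divergence `D(P_β ‖ P_b)` increases with `β`; only the signs of divergences within the
family are used, no derivatives of `log Z`. -/
theorem klDiv_dist_mono (hQ : Q ≠ 0) (hb : b ∈ canonicalSpace Q) {β β' : ℝ}
    (hβ : β ∈ interior (canonicalSpace Q)) (hβ' : β' ∈ interior (canonicalSpace Q)) (hbβ : b ≤ β)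
    (hββ' : β ≤ β') : InformationTheory.klDiv (dist Q β) (dist Q b) ≤
      InformationTheory.klDiv (dist Q β') (dist Q b) := by
  have hβc := interior_subset hβ
  have hβc' := interior_subset hβ'
  rw [(klDiv_dist hQ hβc hb (integrable_id_dist hβ)).1,
    (klDiv_dist hQ hβc' hb (integrable_id_dist hβ')).1]
  refine ENNReal.ofReal_le_ofReal ?_
  have h1 := (klDiv_dist hQ hβc hβc' (integrable_id_dist hβ)).2
  have h2 := (klDiv_dist hQ hβc' hβc (integrable_id_dist hβ')).2
  set μ := ∫ x, x ∂dist Q β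
  set μ' := ∫ x, x ∂dist Q β'
  rcases hββ'.eq_or_lt with h | h
  · have : μ = μ' := by rw [show μ = ∫ x, x ∂dist Q β from rfl, h]
    rw [this, h]
  · -- The two divergences add up to `(β' - β) * (μ' - μ)`, so that the mean is increasing.
    have hmono : μ ≤ μ' := by
      by_contra! hlt
      nlinarith [mul_pos (sub_pos.2 h) (sub_pos.2 hlt)]
    nlinarith [mul_nonneg (sub_nonneg.2 hbβ) (sub_nonneg.2 hmono)]

theorem exists_tendsto_klDiv_right_of_atom (hQ : Q ≠ 0) (hb : b ∈ interior (canonicalSpace Q))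
    (hatom : Q {x₀} ≠ 0) (h : Q (Set.Ioi x₀) = 0) : ∃ l : ℝ≥0, Tendsto
      (fun β => InformationTheory.klDiv (dist Q β) (dist Q b)) atTop (𝓝 (l : ℝ≥0∞)) := by
  have hb' := interior_subset hb
  obtain ⟨C, hC, hle⟩ := exists_klDiv_le_of_atom hQ hb' hatom h
  have hint : ∀ β, b ≤ β → β ∈ interior (canonicalSpace Q) := fun β hβ =>
    mem_interior_canonicalSpace hb
      (mem_canonicalSpace_of_measure_Ioi hb' h (hβ.trans (lt_add_one β).le)) hβ (lt_add_one β)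
  have hmono : Monotone fun β => InformationTheory.klDiv (dist Q (max b β)) (dist Q b) :=
    fun β β' hββ' => klDiv_dist_mono hQ hb' (hint _ (le_max_left _ _)) (hint _ (le_max_left _ _))
      (le_max_left _ _) (max_le_max le_rfl hββ')
  have hlim := tendsto_atTop_iSup hmono
  have hfin : (⨆ β, InformationTheory.klDiv (dist Q (max b β)) (dist Q b)) ≠ ∞ :=
    ne_top_of_le_ne_top hC (iSup_le fun β => hle _ (le_max_left _ _))
  refine ⟨(⨆ β, InformationTheory.klDiv (dist Q (max b β)) (dist Q b)).toNNReal, ?_⟩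
  rw [ENNReal.coe_toNNReal hfin]
  refine hlim.congr' ?_
  filter_upwards [eventually_ge_atTop b] with β hβ
  rw [max_eq_right hβ]

theorem exists_tendsto_klDiv_of_isClosedAtRightEnd (hQ : Q ≠ 0)
    (hb : b ∈ interior (canonicalSpace Q)) (hΓ : Γ = {β ∈ canonicalSpace Q | b ≤ β})
    (h : IsClosedAtRightEnd Q Γ) :
    (∃ l : ℝ≥0, Tendsto (fun β => InformationTheory.klDiv (dist Q b) (dist Q β))
      (toRightEnd Γ) (𝓝 (l : ℝ≥0∞))) ∨
    ∃ l : ℝ≥0, Tendsto (fun β => InformationTheory.klDiv (dist Q β) (dist Q b))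
      (toRightEnd Γ) (𝓝 (l : ℝ≥0∞)) := by
  rcases h with ⟨s, hs, hmax⟩ | ⟨x₀, hatom, h0⟩
  · left
    have hsc := (hΓ ▸ hs : s ∈ {β ∈ canonicalSpace Q | b ≤ β})
    rcases leftTruncated_cases hb hΓ with ⟨hΓ', -⟩ | ⟨t, hbt, hsub, hsup, hf⟩
    · have hs1 : s + 1 ∈ Γ := by
        rw [hΓ']
        exact hsc.2.trans (lt_add_one s).le
      exact absurd (hmax _ hs1) (lt_add_one s).not_ge
    · obtain rfl : s = t := by
        refine le_antisymm (hsup hs).2 (le_of_forall_lt fun r hr => ?_)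
        obtain ⟨u, hu, hut⟩ := exists_between (max_lt hbt hr)
        exact ((le_max_right b r).trans_lt hu).trans_le
          (hmax u (hsub ⟨(le_max_left b r).trans hu.le, hut⟩))
      rw [hf]
      exact exists_tendsto_klDiv_left_of_max hQ hb hsc.1 hbt
  · right
    rcases leftTruncated_cases hb hΓ with ⟨-, hf⟩ | ⟨t, hbt, -, hsup, -⟩
    · rw [hf]
      exact exists_tendsto_klDiv_right_of_atom hQ hb hatom h0
    · have hle : b ≤ t + 1 := hbt.le.trans (lt_add_one t).le
      have ht1 : t + 1 ∈ Γ :=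
        hΓ ▸ ⟨mem_canonicalSpace_of_measure_Ioi (interior_subset hb) h0 hle, hle⟩
      exact absurd (hsup ht1).2 (lt_add_one t).not_ge

end ExpFamily

namespace ExpFamily

variable {Q : Measure ℝ} {Γ : Set ℝ} {b β : ℝ}

/-! ### The Shtarkov integral, regret, redundancy and capacity -/

theorem density_le_maxLikelihood (Q : Measure ℝ) (hβ : β ∈ Γ) (x : ℝ) :
    density Q β x ≤ maxLikelihood Q Γ x :=
  le_iSup₂_of_le β hβ le_rfl

theorem one_le_shtarkov (hQ : Q ≠ 0) (hβ : β ∈ canonicalSpace Q) (hβΓ : β ∈ Γ) :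
    1 ≤ shtarkov Q Γ := by
  rw [← lintegral_density hQ hβ]
  exact lintegral_mono (density_le_maxLikelihood Q hβΓ)

/-- No probability measure `R` has a smaller regret than `log S`: the density of `R` integrates to
at most one, so it cannot exceed `M / S` almost everywhere, for the maximum likelihood `M`. -/
theorem log_shtarkov_le_regret (Q : Measure ℝ) (Γ : Set ℝ) (R : Measure ℝ)
    [IsProbabilityMeasure R] [SigmaFinite Q] :
    ENNReal.log (shtarkov Q Γ) ≤ regret Q Γ R := by
  rw [← EReal.log_exp (regret Q Γ R), ENNReal.log_le_log_iff]
  rcases eq_or_ne (EReal.exp (regret Q Γ R)) ∞ with htop | htop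
  · rw [htop]
    exact le_top
  calc shtarkov Q Γ ≤ ∫⁻ x, EReal.exp (regret Q Γ R) * R.rnDeriv Q x ∂Q := by
        refine lintegral_mono_ae ?_
        filter_upwards [ae_le_essSup (μ := Q)
          (f := fun x => ENNReal.log (maxLikelihood Q Γ x / R.rnDeriv Q x)),
          R.rnDeriv_lt_top Q] with x hx hlt
        have hexp : maxLikelihood Q Γ x / R.rnDeriv Q x ≤ EReal.exp (regret Q Γ R) := by
          rw [← ENNReal.log_le_log_iff, EReal.log_exp]
          exact hx
        exact (ENNReal.div_le_iff_le_mul (Or.inr htop) (Or.inl hlt.ne)).1 hexp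
    _ = EReal.exp (regret Q Γ R) * ∫⁻ x, R.rnDeriv Q x ∂Q := lintegral_const_mul' _ _ htop
    _ ≤ EReal.exp (regret Q Γ R) * 1 := by
        gcongr
        exact Measure.lintegral_rnDeriv_le.trans prob_le_one
    _ = _ := mul_one _

/-- The normalized maximum likelihood distribution, with density proportional to the maximum
likelihood. It is a probability measure if the Shtarkov integral is finite. -/
noncomputable def normalizedMaxLikelihood (Q : Measure ℝ) (Γ : Set ℝ) : Measure ℝ :=
  Q.withDensity fun x => maxLikelihood Q Γ x / shtarkov Q Γ

theorem isProbabilityMeasure_normalizedMaxLikelihood (h0 : shtarkov Q Γ ≠ 0)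
    (h : shtarkov Q Γ ≠ ∞) : IsProbabilityMeasure (normalizedMaxLikelihood Q Γ) := by
  refine ⟨?_⟩
  rw [normalizedMaxLikelihood, withDensity_apply _ MeasurableSet.univ, setLIntegral_univ]
  simp_rw [div_eq_mul_inv]
  rw [lintegral_mul_const _ (measurable_maxLikelihood Q Γ)]
  exact ENNReal.mul_inv_cancel h0 h

theorem regret_normalizedMaxLikelihood_le [SigmaFinite Q] (h0 : shtarkov Q Γ ≠ 0)
    (h : shtarkov Q Γ ≠ ∞) :
    regret Q Γ (normalizedMaxLikelihood Q Γ) ≤ ENNReal.log (shtarkov Q Γ) := by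
  refine essSup_le_of_ae_le _ ?_
  filter_upwards [Q.rnDeriv_withDensity ((measurable_maxLikelihood Q Γ).div_const (shtarkov Q Γ))]
    with x hx
  rw [normalizedMaxLikelihood, hx, ENNReal.log_le_log_iff]
  refine ENNReal.div_le_of_le_mul ?_
  exact (ENNReal.mul_div_cancel h0 h).ge

theorem minimaxRegret_eq (hQ : Q ≠ 0) (hβ : β ∈ canonicalSpace Q) (hβΓ : β ∈ Γ)
    (h : shtarkov Q Γ ≠ ∞) : minimaxRegret Q Γ = ENNReal.log (shtarkov Q Γ) := by
  have := sigmaFinite_of_mem hβ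
  have h0 : shtarkov Q Γ ≠ 0 := (one_pos.trans_le (one_le_shtarkov hQ hβ hβΓ)).ne'
  refine le_antisymm (iInf₂_le_of_le (normalizedMaxLikelihood Q Γ)
    (isProbabilityMeasure_normalizedMaxLikelihood h0 h) (regret_normalizedMaxLikelihood_le h0 h))
    (le_iInf₂ fun R hR => log_shtarkov_le_regret Q Γ R)

theorem exists_minimaxRegret_eq_coe_iff (hQ : Q ≠ 0) (hβ : β ∈ canonicalSpace Q) (hβΓ : β ∈ Γ) :
    (∃ r : ℝ, minimaxRegret Q Γ = (r : EReal)) ↔ shtarkov Q Γ < ∞ := by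
  have := sigmaFinite_of_mem hβ
  refine ⟨fun ⟨r, hr⟩ => ?_, fun h => ?_⟩
  · have hle : ENNReal.log (shtarkov Q Γ) ≤ minimaxRegret Q Γ :=
      le_iInf₂ fun R hR => log_shtarkov_le_regret Q Γ R
    rw [hr] at hle
    exact ENNReal.log_lt_top_iff.1 (hle.trans_lt (EReal.coe_lt_top r))
  · refine ⟨(ENNReal.log (shtarkov Q Γ)).toReal, ?_⟩
    have h0 : shtarkov Q Γ ≠ 0 := (one_pos.trans_le (one_le_shtarkov hQ hβ hβΓ)).ne'
    rw [minimaxRegret_eq hQ hβ hβΓ h.ne, EReal.coe_toReal]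
    · simpa using h.ne
    · simpa using h0

theorem minimaxRedundancy_lt_top (hQ : Q ≠ 0) (hb : b ∈ Γ) (hΓ : Γ ⊆ canonicalSpace Q)
    (h : shtarkov Q Γ < ∞) : minimaxRedundancy Q Γ < ∞ := by
  have h0 : shtarkov Q Γ ≠ 0 := (one_pos.trans_le (one_le_shtarkov hQ (hΓ hb) hb)).ne'
  have hprob := isProbabilityMeasure_normalizedMaxLikelihood h0 h.ne
  refine (iInf₂_le_of_le (normalizedMaxLikelihood Q Γ) hprob (iSup₂_le fun β hβ => ?_)).trans_lt
    (ENNReal.add_lt_top.2 ⟨h, ENNReal.one_lt_top⟩)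
  have : IsProbabilityMeasure (Q.withDensity (density Q β)) :=
    isProbabilityMeasure_dist hQ (hΓ hβ)
  have : IsProbabilityMeasure
      (Q.withDensity fun x => maxLikelihood Q Γ x / shtarkov Q Γ) := hprob
  refine (klDiv_withDensity_le Q (measurable_density Q β)
    ((measurable_maxLikelihood Q Γ).div_const _) (ae_of_all _ fun x => ?_) ?_).trans ?_
  · refine (ENNReal.div_pos ?_ h.ne).ne'
    exact ((density_ne_zero hQ (hΓ hβ) x).bot_lt.trans_le (density_le_maxLikelihood Q hβ x)).ne'
  · filter_upwards [ae_lt_top (measurable_maxLikelihood Q Γ) h.ne] with x hx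
    exact ENNReal.div_ne_top hx.ne h0
  · gcongr
    calc ∫⁻ x, density Q β x * (density Q β x / (maxLikelihood Q Γ x / shtarkov Q Γ)) ∂Q
        ≤ ∫⁻ x, density Q β x * shtarkov Q Γ ∂Q := by
          refine lintegral_mono fun x => ?_
          gcongr
          refine ENNReal.div_le_of_le_mul ?_
          rw [ENNReal.mul_div_cancel h0 h.ne]
          exact density_le_maxLikelihood Q hβ x
      _ = shtarkov Q Γ := by
          rw [lintegral_mul_const' _ _ h.ne, lintegral_density hQ (hΓ hβ), one_mul]

theorem measurable_uncurry_density [SigmaFinite Q] :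
    Measurable fun p : ℝ × ℝ => density Q p.1 p.2 := by
  have hZ : Measurable (partitionFunction Q) := by
    have : StronglyMeasurable fun p : ℝ × ℝ => Real.exp (p.1 * p.2) :=
      (by fun_prop : Measurable fun p : ℝ × ℝ => Real.exp (p.1 * p.2)).stronglyMeasurable
    exact (this.integral_prod_right (ν := Q)).measurable
  unfold density
  fun_prop

/-- The mutual information is bounded by `∫ (∫ p_β² / m dQ) dπ(β) + 1`, where `m` is the density of
the output distribution, and `p_β² / m ≤ p_β M / m` for the maximum likelihood `M`; integrating
over `β` first, `m` cancels. -/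
theorem capacity_le_shtarkov_add_one (hQ : Q ≠ 0) (hb : b ∈ canonicalSpace Q)
    (hΓ : Γ ⊆ canonicalSpace Q) : capacity Q Γ ≤ shtarkov Q Γ + 1 := by
  have := sigmaFinite_of_mem hb
  refine iSup₂_le fun π hπ => ?_
  have hmeas : Measurable fun p : Γ × ℝ => density Q p.1 p.2 :=
    measurable_uncurry_density.comp
      ((measurable_subtype_coe.comp measurable_fst).prodMk measurable_snd)
  have hdens : ∀ x, Measurable fun β : Γ => density Q β x := fun x =>
    hmeas.comp measurable_prodMk_right
  have hdist : Measurable fun β : Γ => dist Q β := (measurable_dist hb).comp measurable_subtype_coe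
  set m : ℝ → ℝ≥0∞ := fun x => ∫⁻ β : Γ, density Q β x ∂π with hm
  have hmm : Measurable m := hmeas.lintegral_prod_left'
  have hout : outputDist Q Γ π = Q.withDensity m := by
    ext A hA
    rw [outputDist, Measure.bind_apply hA hdist.aemeasurable, withDensity_apply _ hA]
    simp_rw [dist, withDensity_apply _ hA]
    exact lintegral_lintegral_swap hmeas.aemeasurable
  have hprob : IsProbabilityMeasure (Q.withDensity m) := by
    rw [← hout]
    exact isProbabilityMeasure_bind hdist.aemeasurable
      (ae_of_all _ fun β => isProbabilityMeasure_dist hQ (hΓ β.2))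
  have hm0 : ∀ x, m x ≠ 0 := fun x h => by
    have h' := (lintegral_eq_zero_iff (hdens x)).1 h
    obtain ⟨β, hβ⟩ := h'.exists
    exact density_ne_zero hQ (hΓ β.2) x hβ
  have hmt : ∀ᵐ x ∂Q, m x ≠ ∞ := by
    have h1 : ∫⁻ x, m x ∂Q ≠ ∞ := by
      rw [← setLIntegral_univ, ← withDensity_apply _ MeasurableSet.univ]
      exact measure_ne_top _ _
    filter_upwards [ae_lt_top hmm h1] with x hx using hx.ne
  calc mutualInfo Q Γ π
      ≤ ∫⁻ β : Γ, ((∫⁻ x, density Q β x * (maxLikelihood Q Γ x / m x) ∂Q) + 1) ∂π := by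
        refine lintegral_mono fun β => ?_
        have : IsProbabilityMeasure (Q.withDensity (density Q β)) :=
          isProbabilityMeasure_dist hQ (hΓ β.2)
        rw [hout]
        refine (klDiv_withDensity_le Q (measurable_density Q β) hmm (ae_of_all _ hm0) hmt).trans ?_
        gcongr with x
        exact density_le_maxLikelihood Q β.2 x
    _ = (∫⁻ β : Γ, (∫⁻ x, density Q β x * (maxLikelihood Q Γ x / m x) ∂Q) ∂π) + 1 := by
        rw [lintegral_add_right _ measurable_const]
        simp
    _ = (∫⁻ x, (∫⁻ β : Γ, density Q β x * (maxLikelihood Q Γ x / m x) ∂π) ∂Q) + 1 := by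
        rw [lintegral_lintegral_swap]
        exact (hmeas.mul (((measurable_maxLikelihood Q Γ).div hmm).comp
          measurable_snd)).aemeasurable
    _ ≤ shtarkov Q Γ + 1 := by
        gcongr
        refine lintegral_mono fun x => ?_
        rw [lintegral_mul_const _ (hdens x)]
        exact ENNReal.mul_div_le

end ExpFamily

theorem theorem1 (Q : Measure ℝ) (hQ : Q ≠ 0) (Γ : Set ℝ)
    (hΓ : ExpFamily.IsLeftTruncated Q Γ) :
    List.TFAE [
      ExpFamily.shtarkov Q Γ < ∞,
      ∃ r : ℝ, ExpFamily.minimaxRegret Q Γ = (r : EReal),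
      ExpFamily.minimaxRedundancy Q Γ < ∞,
      ∃ Qdom : Measure ℝ, IsProbabilityMeasure Qdom ∧
        (⨆ β ∈ Γ, InformationTheory.klDiv (ExpFamily.dist Q β) Qdom) < ∞,
      ∃ β₁ ∈ Γ,
        (⨆ β ∈ Γ, InformationTheory.klDiv (ExpFamily.dist Q β) (ExpFamily.dist Q β₁)) < ∞,
      ExpFamily.capacity Q Γ < ∞,
      ∃ β₀ ∈ Γ,
        (∃ l : ℝ≥0, Tendsto
          (fun β => InformationTheory.klDiv (ExpFamily.dist Q β₀) (ExpFamily.dist Q β))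
          (ExpFamily.toRightEnd Γ) (𝓝 (l : ℝ≥0∞))) ∨
        (∃ l : ℝ≥0, Tendsto
          (fun β => InformationTheory.klDiv (ExpFamily.dist Q β) (ExpFamily.dist Q β₀))
          (ExpFamily.toRightEnd Γ) (𝓝 (l : ℝ≥0∞)))] := by
  obtain ⟨b, hb, hΓ⟩ := hΓ
  have hb' := interior_subset hb
  have hbΓ : b ∈ Γ := hΓ ▸ ⟨hb', le_rfl⟩
  have hsub : Γ ⊆ ExpFamily.canonicalSpace Q := hΓ ▸ fun β hβ => hβ.1
  -- The link back from a bound on the divergences to the other statements: the family is closed at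
  -- its right end.
  have hclosed (R : Measure ℝ) [IsProbabilityMeasure R]
      (h : (⨆ β ∈ Γ, InformationTheory.klDiv (ExpFamily.dist Q β) R) < ∞) :
      ExpFamily.IsClosedAtRightEnd Q Γ := by
    refine ExpFamily.isClosedAtRightEnd_of_klDiv_le hQ hb hΓ R h.ne ?_
    filter_upwards [ExpFamily.eventually_mem_toRightEnd hb hΓ] with β hβ
    exact le_iSup₂ (f := fun β (_ : β ∈ Γ) => InformationTheory.klDiv (ExpFamily.dist Q β) R) β hβ
  tfae_have 2 ↔ 1 := ExpFamily.exists_minimaxRegret_eq_coe_iff hQ hb' hbΓ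
  tfae_have 1 → 3 := ExpFamily.minimaxRedundancy_lt_top hQ hbΓ hsub
  tfae_have 3 → 4 := fun h => by
    obtain ⟨R, h⟩ := iInf_lt_iff.1 h
    obtain ⟨hR, h⟩ := iInf_lt_iff.1 h
    exact ⟨R, hR, h⟩
  tfae_have 1 → 6 := fun h => (ExpFamily.capacity_le_shtarkov_add_one hQ hb' hsub).trans_lt
    (ENNReal.add_lt_top.2 ⟨h, ENNReal.one_lt_top⟩)
  tfae_have 4 → 5 := fun ⟨R, hR, h⟩ =>
    ExpFamily.exists_iSup_klDiv_lt_top_of_isClosedAtRightEnd hQ hb hΓ (hclosed R h)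
  tfae_have 5 → 7 := fun ⟨β₁, hβ₁, h⟩ => by
    have := ExpFamily.isProbabilityMeasure_dist hQ (hsub hβ₁)
    exact ⟨b, hbΓ, ExpFamily.exists_tendsto_klDiv_of_isClosedAtRightEnd hQ hb hΓ (hclosed _ h)⟩
  tfae_have 6 → 1 := fun h => ExpFamily.shtarkov_lt_top_of_isClosedAtRightEnd hQ hb hΓ
    (ExpFamily.isClosedAtRightEnd_of_capacity_lt_top hQ hb hΓ h)
  tfae_have 7 → 1 := by
    rintro ⟨β₀, hβ₀, ⟨l, hl⟩ | ⟨l, hl⟩⟩ <;>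
      refine ExpFamily.shtarkov_lt_top_of_isClosedAtRightEnd hQ hb hΓ ?_
    · exact ExpFamily.isClosedAtRightEnd_of_tendsto_klDiv_left hQ hb hΓ hβ₀ hl
    · have := ExpFamily.isProbabilityMeasure_dist hQ (hsub hβ₀)
      have hlt : (l : ℝ≥0∞) < l + 1 := ENNReal.lt_add_right ENNReal.coe_ne_top one_ne_zero
      exact ExpFamily.isClosedAtRightEnd_of_klDiv_le hQ hb hΓ (ExpFamily.dist Q β₀)
        (ENNReal.add_ne_top.2 ⟨ENNReal.coe_ne_top, ENNReal.one_ne_top⟩)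
        ((hl.eventually (gt_mem_nhds hlt)).mono fun β hβ => le_of_lt hβ)
  tfae_finish
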